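/- Consider the following real differential-difference equations of Volterra type $\dot u_n=f(u_{n-1},u_n,u_{n+1})$, $n\in\mathbb Z$, on the set where $u_{n+1}\neq u_{n-1}$: $$\text{(a)}\quad \dot u_n = e^{\rho \arctan u_n}\,\frac{(u_{n+1}u_{n-1}+1)(1+u_n^2)}{u_{n+1}-u_{n-1}},\qquad \rho\neq 0;$$ $$\text{(b)}\quad \dot u_n = u_n^{\rho}\,\frac{u_{n+1}u_{n-1}+Au_n(u_{n+1}+u_{n-1})+Bu_n^2}{u_{n+1}-u_{n-1}},\qquad \rho\neq 0,\ (\rho,A,B)\notin\{(1,\tfrac12,0),(2,0,0)\};$$ $$\text{(c)}\quad \dot u_n = e^{u_n}\,\frac{u_{n+1}u_{n-1}+(A-u_n)(u_{n+1}+u_{n-1})+u_n^2-2Au_n}{u_{n+1}-u_{n-1}},$$ where $\rho,A,B$ are real constants and in (b) $u_n>0$, or, if $\rho$ is an integer, $u_n\neq0$. (The hypotheses in (b) hold in particular whenever $u^\rho$, $Au^{\rho+1}$, $Bu^{\rho+2}$ are not all polynomials of degree at most two and $\rho\ne0$; the two excluded triples give polynomial, integrable equations.) By a local domain of such an equation we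 mean a product $\prod_{n\in\mathbb Z} I_n$ of nonempty open intervals, all of whose sequences $(u_n)$ are admissible for the equation at every site. A generalized symmetry on a local domain, for $t$ in an open set, is a family of smooth functions $g_n=g_n(t,u_{n-N},\dots,u_{n+N})$, with some fixed $N$, such that $$D_t g_n=\sum_{k=n-1}^{n+1}\frac{\partial f_n}{\partial u_k}\,g_k\qquad(n\in\mathbb Z),$$ where $f_n=f(u_{n-1},u_n,u_{n+1})$ and $D_t$ is the total time derivative along the equation. It is a higher generalized symmetry if $\partial g_n/\partial u_{n+j}\not\equiv0$ for some $n$ and some $j$ with $|j|\ge2$. Then none of the equations (a), (b), (c) is integrable: none of them has a higher generalized symmetry on any local domain. Moreover, each of them violates, on every local domain, the condition $$\frac{\delta}{\delta u_n}\,D_t\log\Bigl|\frac{\partial f_n}{\partial u_{n+1}}\Bigr|=0,\qquad \frac{\delta a_n}{\delta u_n}:=\sum_{k}\frac{\partial a_k}{\partial u_n}:$$ every local domain contains a sequence with $\partial f_k/\partial u_{k+1}\ne0$ for all $k$ at which the left-hand side is nonzero for some $n$. -/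

import Mathlib

open scoped ContDiff

noncomputable section

namespace Lattice

/-- A real autonomous differential-difference equation of Volterra type
`du_n/dt = f(u_{n-1}, u_n, u_{n+1})`: the right-hand side `f` together with the set of triples
`(u_{n-1}, u_n, u_{n+1})` on which the equation is considered. -/
structure VolterraEq where
  /-- the right-hand side, with arguments in the order `u_{n-1}, u_n, u_{n+1}` -/
  f : ℝ → ℝ → ℝ → ℝ
  /-- the admissible triples `u_{n-1}, u_n, u_{n+1}` -/
  dom : ℝ → ℝ → ℝ → Prop

/-- The right-hand side at the lattice site `n`, as a function of the whole sequence: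
`f_n(u) = f(u_{n-1}, u_n, u_{n+1})`. -/
def VolterraEq.rhs (E : VolterraEq) (n : ℤ) (u : ℤ → ℝ) : ℝ :=
  E.f (u (n - 1)) (u n) (u (n + 1))

/-- The partial derivative `∂a/∂u_k` at `u` of a function `a` of a sequence. -/
def pderiv (a : (ℤ → ℝ) → ℝ) (k : ℤ) (u : ℤ → ℝ) : ℝ :=
  deriv (fun s => a (Function.update u k s)) (u k)

/-- The derivative along the equation, `∑_k ∂a_n/∂u_k f_k`, of a function `a_n` which depends
only on `u_{n-r}, …, u_{n+r}` (and not explicitly on `t`). -/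
def flowDeriv (E : VolterraEq) (r : ℕ) (a : (ℤ → ℝ) → ℝ) (n : ℤ) (u : ℤ → ℝ) : ℝ :=
  ∑ k ∈ Finset.Icc (n - r) (n + r), pderiv a k u * E.rhs k u

/-- The variational derivative `δa/δu_n = ∑_k ∂a_k/∂u_n` of a family `a_k` of functions,
`a_k` depending only on `u_{k-r}, …, u_{k+r}`. -/
def varDeriv (r : ℕ) (a : ℤ → (ℤ → ℝ) → ℝ) (n : ℤ) (u : ℤ → ℝ) : ℝ :=
  ∑ k ∈ Finset.Icc (n - r) (n + r), pderiv (a k) n u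

/-- `log (∂f_n/∂u_{n+1})`, a function of `u_{n-1}, u_n, u_{n+1}`.  Here `Real.log x = log |x|`;
the sign is immaterial, since only derivatives of this function are used. -/
def logSeparant (E : VolterraEq) (n : ℤ) (u : ℤ → ℝ) : ℝ :=
  Real.log (pderiv (E.rhs n) (n + 1) u)

/-- The sequences `u` with `u_n ∈ I_n` for all `n`. -/
def box (I : ℤ → Set ℝ) : Set (ℤ → ℝ) :=
  {u | ∀ n, u n ∈ I n}

/-- Local domains of the equation: products `∏ I_n` of nonempty open intervals, all of whose
sequences are admissible for the equation at every lattice site. -/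
structure IsLocalDomain (E : VolterraEq) (I : ℤ → Set ℝ) : Prop where
  isOpen : ∀ n, IsOpen (I n)
  ordConnected : ∀ n, (I n).OrdConnected
  nonempty : ∀ n, (I n).Nonempty
  admissible : ∀ u ∈ box I, ∀ n, E.dom (u (n - 1)) (u n) (u (n + 1))

/-- The condition `δ/δu_n ∂_t log (∂f/∂u_{n+1}) = 0` on the local domain `∏ I_n`, required at
those sequences where the logarithms make sense.  The function `∂_t log (∂f_n/∂u_{n+1})` depends
on `u_{n-2}, …, u_{n+2}`. -/
def FirstConditionOn (E : VolterraEq) (I : ℤ → Set ℝ) : Prop :=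
  ∀ u ∈ box I, (∀ k, pderiv (E.rhs k) (k + 1) u ≠ 0) →
    ∀ n, varDeriv 2 (fun k => flowDeriv E 1 (logSeparant E k) k) n u = 0

/-- Values of `u_{n-N}, …, u_{n+N}`, indexed by the offset from `n`. -/
abbrev Window (N : ℕ) : Type :=
  Finset.Icc (-(N : ℤ)) (N : ℤ) → ℝ

/-- The values `u_{n-N}, …, u_{n+N}` of a sequence around the site `n`. -/
def window (N : ℕ) (n : ℤ) (u : ℤ → ℝ) : Window N :=
  fun k => u (n + k)

/-- The family `G_n(t, u_{n-N}, …, u_{n+N})`, as functions of `t` and of the whole sequence. -/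
def onSeq {N : ℕ} (G : ℤ → ℝ × Window N → ℝ) (n : ℤ) (t : ℝ) (u : ℤ → ℝ) : ℝ :=
  G n (t, window N n u)

/-- `g_n = G_n(t, u_{n-N}, …, u_{n+N})` is (the characteristic of) a generalized symmetry
`du_n/dε = g_n` of the equation, for `t ∈ J` and `u ∈ ∏ I_n`: the `g_n` are smooth, and the two
flows commute, that is, the `g_n` satisfy the linearized equation
`D_t g_n = ∑_{|k-n| ≤ 1} ∂f_n/∂u_k g_k` on solutions, `D_t` being the total derivative along the
equation.  Explicit dependence on `n` and `t` is allowed. -/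
structure IsGeneralizedSymmetry (E : VolterraEq) (J : Set ℝ) (I : ℤ → Set ℝ) {N : ℕ}
    (G : ℤ → ℝ × Window N → ℝ) : Prop where
  smooth : ∀ n, ContDiffOn ℝ ∞ (G n)
    (J ×ˢ {w : Window N | ∀ k : Finset.Icc (-(N : ℤ)) (N : ℤ), w k ∈ I (n + k)})
  determining : ∀ n, ∀ t ∈ J, ∀ u ∈ box I,
    deriv (fun s => onSeq G n s u) t + flowDeriv E N (onSeq G n t) n u =
      ∑ k ∈ Finset.Icc (n - 1) (n + 1), pderiv (E.rhs n) k u * onSeq G k t u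

/-- The family `g_n` is of higher order: some `g_n` depends effectively on a variable `u_{n+j}`
with `|j| ≥ 2`, i.e. on more than the variables `u_{n-1}, u_n, u_{n+1}` of the equation. -/
def IsHigherOrder (J : Set ℝ) (I : ℤ → Set ℝ) {N : ℕ} (G : ℤ → ℝ × Window N → ℝ) : Prop :=
  ∃ n : ℤ, ∃ t ∈ J, ∃ u ∈ box I, ∃ j : ℤ, 2 ≤ |j| ∧ pderiv (onSeq G n t) (n + j) u ≠ 0

/-- The equation has a higher generalized symmetry, at least locally: on some local domain and
for `t` in some open set. -/
def HasHigherSymmetry (E : VolterraEq) : Prop :=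
  ∃ (J : Set ℝ) (I : ℤ → Set ℝ) (N : ℕ) (G : ℤ → ℝ × Window N → ℝ),
    IsOpen J ∧ IsLocalDomain E I ∧ IsGeneralizedSymmetry E J I G ∧ IsHigherOrder J I G

/-- `du_n/dt = e^{ρ arctan u_n} (u_{n+1} u_{n-1} + 1) (1 + u_n²) / (u_{n+1} - u_{n-1})`. -/
def eqArctan (ρ : ℝ) : VolterraEq where
  f := fun y u x => Real.exp (ρ * Real.arctan u) * ((x * y + 1) * (1 + u ^ 2)) / (x - y)
  dom := fun y _ x => x ≠ y

/-- `du_n/dt = u_n^ρ (u_{n+1} u_{n-1} + A u_n (u_{n+1} + u_{n-1}) + B u_n²) / (u_{n+1} - u_{n-1})`,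
considered for `u_n > 0`, and also for `u_n < 0` if the exponent `ρ` is an integer. -/
def eqPower (ρ A B : ℝ) : VolterraEq where
  f := fun y u x => u ^ ρ * (x * y + A * u * (x + y) + B * u ^ 2) / (x - y)
  dom := fun y u x => x ≠ y ∧ (0 < u ∨ (u < 0 ∧ ∃ m : ℤ, ρ = m))

/-- `du_n/dt = e^{u_n} (u_{n+1} u_{n-1} + (-u_n + A)(u_{n+1} + u_{n-1}) + u_n² - 2 A u_n) /
(u_{n+1} - u_{n-1})`. -/
def eqExp (A : ℝ) : VolterraEq where
  f := fun y u x =>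
    Real.exp u * (x * y + (-u + A) * (x + y) + u ^ 2 - 2 * A * u) / (x - y)
  dom := fun y _ x => x ≠ y

end Lattice

end

/-!
All three equations have the form `du_n/dt = R(u_{n-1}, u_n, u_{n+1}) / (u_{n+1} - u_{n-1})` with
`R(y, u, x) = a(u) x y + b(u) (x + y) + c(u)`, see `IsFractional`.  Put
`r(y, u) = R(y, u, y) = a(u) y² + 2 b(u) y + c(u)` (`diag`); then
`∂f_n/∂u_{n+1} = -r(u_{n-1}, u_n) / (u_{n+1} - u_{n-1})²`.  Since `a` has no zeros, every local
domain contains one on which no separant vanishes (`IsFractional.exists_isRegularDomain`), so it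
suffices to argue on such regular domains.

*The first condition forces `r` to be symmetric* (`FirstConditionOn.diag_symm`).  In the sum of all
`∂_t log (∂f_k/∂u_{k+1})` the variables `u_{n-1}` and `u_{n+2}` occur together only in
`2 (R(u_{n-1}, u_n, u_{n+1}) - R(u_n, u_{n+1}, u_{n+2})) / ((u_{n+1} - u_{n-1}) (u_{n+2} - u_n))`.
The numerator is affine in `u_{n-1}` and in `u_{n+2}`, and the part of the quotient that does not
split into functions of only one of them is a multiple of `r(u_{n+1}, u_n) - r(u_n, u_{n+1})`.  For
the three equations `r` is not symmetric on any product of intervals: for the first one because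
`exp (ρ arctan u)` is not constant, for the others because symmetry would make `a` locally a
quadratic polynomial (`third_deriv_eq_zero_of_diag_symm`).  The exponential function is none, and
for `u ^ ρ` only `ρ = 1` and `ρ = 2` are left, with exactly the two excluded triples.

*A higher symmetry forces the first condition* (`IsGeneralizedSymmetry.firstConditionOn`).  Let
`m ≥ 2` be the largest number such that some `g_n` depends on `u_{n+m}`.  Differentiating the
determining equation with respect to `u_{n+m+1}` shows that
`∂g_n/∂u_{n+m} = γ(t) ∏_{i<m} ∂f_{n+i}/∂u_{n+i+1}`.  Differentiating it with respect to `u_{n+m}`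
and dividing by the leading coefficient shows that the sum of `∂_t log (∂f_{n+i}/∂u_{n+i+1})` over
`i < m` is of the form `S_{n+1} - S_n + const`, and such an expression has zero variational
derivative.  Symmetries which depend on `u_{n-m}` are reduced to this case by the invariance of the
equation under `n ↦ -n`, `t ↦ -t` (`IsGeneralizedSymmetry.reflect`).
-/

open Filter Topology

namespace Lattice

/-! ### Partial derivatives of functions of a sequence -/

lemma update_mem_box {I : ℤ → Set ℝ} {u : ℤ → ℝ} (hu : u ∈ box I) {k : ℤ} {s : ℝ} (hs : s ∈ I k) :
    Function.update u k s ∈ box I := by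
  intro n
  by_cases h : n = k
  · subst h; simpa using hs
  · simpa [h] using hu n

lemma eventually_update_mem_box {I : ℤ → Set ℝ} (hI : ∀ k, IsOpen (I k)) {u : ℤ → ℝ}
    (hu : u ∈ box I) (k : ℤ) : ∀ᶠ s in 𝓝 (u k), Function.update u k s ∈ box I := by
  filter_upwards [(hI k).mem_nhds (hu k)] with s hs using update_mem_box hu hs

lemma pderiv_congr_box {I : ℤ → Set ℝ} (hI : ∀ k, IsOpen (I k)) {f g : (ℤ → ℝ) → ℝ}
    (h : ∀ v ∈ box I, f v = g v) {u : ℤ → ℝ} (hu : u ∈ box I) (k : ℤ) :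
    pderiv f k u = pderiv g k u := by
  refine Filter.EventuallyEq.deriv_eq ?_
  filter_upwards [eventually_update_mem_box hI hu k] with s hs using h _ hs

lemma _root_.DependsOn.pderiv {f : (ℤ → ℝ) → ℝ} {S : Set ℤ} (hf : DependsOn f S) (k : ℤ) :
    DependsOn (Lattice.pderiv f k) S := by
  intro u v huv
  by_cases hk : k ∈ S
  · have : (fun s => f (Function.update u k s)) = fun s => f (Function.update v k s) := by
      funext s
      refine hf fun i hi => ?_
      by_cases h : i = k
      · subst h; simp
      · simpa [h] using huv i hi
    simp only [Lattice.pderiv, this, huv k hk]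
  · have h : ∀ w : ℤ → ℝ, (fun s => f (Function.update w k s)) = fun _ => f w := by
      intro w
      funext s
      refine hf fun i hi => ?_
      have : i ≠ k := fun h => hk (h ▸ hi)
      simp [this]
    simp [Lattice.pderiv, h]

lemma _root_.DependsOn.update_eq {f : (ℤ → ℝ) → ℝ} {S : Set ℤ} (hf : DependsOn f S) {k : ℤ}
    (hk : k ∉ S) (u : ℤ → ℝ) (s : ℝ) : f (Function.update u k s) = f u := by
  refine hf fun i hi => ?_
  have : i ≠ k := fun h => hk (h ▸ hi)
  simp [this]

lemma _root_.DependsOn.pderiv_eq_zero {f : (ℤ → ℝ) → ℝ} {S : Set ℤ} (hf : DependsOn f S) {k : ℤ}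
    (hk : k ∉ S) (u : ℤ → ℝ) : Lattice.pderiv f k u = 0 := by
  simp [Lattice.pderiv, hf.update_eq hk]

lemma _root_.DependsOn.superset {f : (ℤ → ℝ) → ℝ} {S T : Set ℤ} (hf : DependsOn f S) (h : S ⊆ T) :
    DependsOn f T := fun _ _ huv => hf fun i hi => huv i (h hi)

lemma differentiable_update (u : ℤ → ℝ) (k j : ℤ) :
    Differentiable ℝ fun s : ℝ => Function.update u k s j := by
  by_cases h : j = k
  · subst h; simp
  · simp [h]

lemma dependsOn_rhs (E : VolterraEq) (n : ℤ) : DependsOn (E.rhs n) (Set.Icc (n - 1) (n + 1)) := by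
  intro u v h
  simp only [VolterraEq.rhs]
  rw [h (n - 1) (by simp; lia), h n (by simp), h (n + 1) (by simp; lia)]

lemma dependsOn_logSeparant (E : VolterraEq) (n : ℤ) :
    DependsOn (logSeparant E n) (Set.Icc (n - 1) (n + 1)) := by
  intro u v h
  simp only [logSeparant]
  rw [(dependsOn_rhs E n).pderiv (n + 1) h]

lemma dependsOn_flowDeriv (E : VolterraEq) (n : ℤ) :
    DependsOn (flowDeriv E 1 (logSeparant E n) n) (Set.Icc (n - 2) (n + 2)) := by
  intro u v h
  simp only [flowDeriv]
  refine Finset.sum_congr rfl fun k hk => ?_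
  simp only [Nat.cast_one, Finset.mem_Icc] at hk
  rw [(dependsOn_logSeparant E n).pderiv k (fun i hi => h i ?_),
    dependsOn_rhs E k (fun i hi => h i ?_)]
  all_goals simp only [Set.mem_Icc] at hi ⊢; lia

/-! ### Equations with right-hand side of the form `R / (u_{n+1} - u_{n-1})` -/

/-- The equation is `du_n/dt = (a(u_n) u_{n+1} u_{n-1} + b(u_n) (u_{n+1} + u_{n-1}) + c(u_n)) /
(u_{n+1} - u_{n-1})` with coefficients of class `C²` on an open set `O` in which all admissible
`u_n` lie, and `a` has no zero in `O`.  Admissible triples have `u_{n+1} ≠ u_{n-1}`, and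
admissibility is symmetric in `u_{n-1}` and `u_{n+1}`. -/
structure IsFractional (E : VolterraEq) (O : Set ℝ) (a b c : ℝ → ℝ) : Prop where
  f_eq : ∀ y u x, E.f y u x = (a u * (x * y) + b u * (x + y) + c u) / (x - y)
  isOpen : IsOpen O
  contDiffOn_a : ContDiffOn ℝ 2 a O
  contDiffOn_b : ContDiffOn ℝ 2 b O
  contDiffOn_c : ContDiffOn ℝ 2 c O
  a_ne : ∀ u ∈ O, a u ≠ 0
  dom_symm : ∀ y u x, E.dom y u x → E.dom x u y
  dom_ne : ∀ y u x, E.dom y u x → x ≠ y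
  dom_mem : ∀ y u x, E.dom y u x → u ∈ O

/-- The value of the numerator at `u_{n+1} = u_{n-1} = y`, `u_n = u`. -/
def diag (a b c : ℝ → ℝ) (y u : ℝ) : ℝ := a u * y ^ 2 + 2 * b u * y + c u

/-- A local domain on which the separants
`∂f_n/∂u_{n+1} = -diag (u_{n-1}) (u_n) / (u_{n+1} - u_{n-1})²` have no zeros. -/
structure IsRegularDomain (E : VolterraEq) (a b c : ℝ → ℝ) (I : ℤ → Set ℝ) : Prop
    extends IsLocalDomain E I where
  diag_ne : ∀ k, ∀ y ∈ I (k - 1), ∀ v ∈ I k, diag a b c y v ≠ 0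

section Explicit

variable {E : VolterraEq} {O : Set ℝ} {a b c : ℝ → ℝ} {I : ℤ → Set ℝ} {u : ℤ → ℝ}

lemma IsLocalDomain.sub_ne (hE : IsFractional E O a b c) (hI : IsLocalDomain E I)
    (hu : u ∈ box I) (k : ℤ) : u (k + 1) - u (k - 1) ≠ 0 :=
  sub_ne_zero.2 (hE.dom_ne _ _ _ (hI.admissible u hu k))

lemma IsLocalDomain.mem (hE : IsFractional E O a b c) (hI : IsLocalDomain E I)
    (hu : u ∈ box I) (k : ℤ) : u k ∈ O :=
  hE.dom_mem _ _ _ (hI.admissible u hu k)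

lemma IsFractional.rhs_eq (hE : IsFractional E O a b c) (k : ℤ) (u : ℤ → ℝ) :
    E.rhs k u = (a (u k) * (u (k + 1) * u (k - 1)) + b (u k) * (u (k + 1) + u (k - 1)) + c (u k)) /
      (u (k + 1) - u (k - 1)) := hE.f_eq _ _ _

lemma IsFractional.differentiableAt_rhs (hE : IsFractional E O a b c) (hI : IsLocalDomain E I)
    (hu : u ∈ box I) (k p : ℤ) :
    DifferentiableAt ℝ (fun s => E.rhs k (Function.update u p s)) (u p) := by
  simp only [hE.rhs_eq]
  have hO := hE.isOpen.mem_nhds (hI.mem hE hu k)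
  have hc := fun j => (differentiable_update u p j).differentiableAt (x := u p)
  have key : ∀ h : ℝ → ℝ, ContDiffOn ℝ 2 h O →
      DifferentiableAt ℝ (fun s => h (Function.update u p s k)) (u p) := by
    intro h hh
    refine DifferentiableAt.fun_comp' (u p) ?_ (hc k)
    simpa using (hh.contDiffAt hO).differentiableAt (by norm_num)
  refine DifferentiableAt.fun_div ?_ ?_ (by simpa using hI.sub_ne hE hu k)
  · exact (((key a hE.contDiffOn_a).mul ((hc _).mul (hc _))).add
      ((key b hE.contDiffOn_b).mul ((hc _).add (hc _)))).add (key c hE.contDiffOn_c)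
  · exact (hc _).sub (hc _)

lemma IsFractional.pderiv_rhs_succ (hE : IsFractional E O a b c) (k : ℤ)
    (hu : u (k + 1) - u (k - 1) ≠ 0) :
    pderiv (E.rhs k) (k + 1) u =
      -diag a b c (u (k - 1)) (u k) / (u (k + 1) - u (k - 1)) ^ 2 := by
  have h1 : k - 1 ≠ k + 1 := by lia
  have h2 : k ≠ k + 1 := by lia
  simp only [pderiv, hE.rhs_eq, Function.update_self, Function.update_of_ne h1,
    Function.update_of_ne h2, diag]
  have hid := hasDerivAt_id (u (k + 1))
  have := (((hid.mul_const (u (k - 1))).const_mul (a (u k))).add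
    ((hid.add_const (u (k - 1))).const_mul (b (u k)))).add_const (c (u k))
  have := (this.div (hid.sub_const (u (k - 1))) hu).deriv
  refine Eq.trans this ?_
  simp only [id]
  field_simp
  simp only [Pi.add_apply]
  ring

lemma IsFractional.pderiv_rhs_ne_zero (hE : IsFractional E O a b c)
    (hI : IsRegularDomain E a b c I) (hu : u ∈ box I) (k : ℤ) :
    pderiv (E.rhs k) (k + 1) u ≠ 0 := by
  have h := hI.sub_ne hE hu k
  rw [hE.pderiv_rhs_succ k h]
  exact div_ne_zero (neg_ne_zero.2 (hI.diag_ne k _ (hu _) _ (hu _))) (pow_ne_zero 2 h)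

/-- The derivative of `diag` with respect to its second argument. -/
noncomputable def diagDeriv (a b c : ℝ → ℝ) (y u : ℝ) : ℝ :=
  deriv a u * y ^ 2 + 2 * deriv b u * y + deriv c u

lemma IsFractional.logSeparant_eq (hE : IsFractional E O a b c)
    (hI : IsRegularDomain E a b c I) (hu : u ∈ box I) (k : ℤ) :
    logSeparant E k u =
      Real.log (diag a b c (u (k - 1)) (u k)) - 2 * Real.log (u (k + 1) - u (k - 1)) := by
  have h := hI.sub_ne hE hu k
  have := hI.diag_ne k _ (hu _) _ (hu _)
  rw [logSeparant, hE.pderiv_rhs_succ k h, Real.log_div (neg_ne_zero.2 this) (pow_ne_zero 2 h),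
    Real.log_neg_eq_log, Real.log_pow]
  norm_num

lemma IsFractional.hasDerivAt_diag_right (hE : IsFractional E O a b c) (y : ℝ) {v : ℝ}
    (hv : v ∈ O) : HasDerivAt (fun s => diag a b c y s) (diagDeriv a b c y v) v := by
  have hO := hE.isOpen.mem_nhds hv
  have key : ∀ h : ℝ → ℝ, ContDiffOn ℝ 2 h O → HasDerivAt h (deriv h v) v := fun h hh =>
    ((hh.contDiffAt hO).differentiableAt (by norm_num)).hasDerivAt
  exact (((key a hE.contDiffOn_a).mul_const (y ^ 2)).add
    (((key b hE.contDiffOn_b).const_mul 2).mul_const y)).add (key c hE.contDiffOn_c)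

lemma hasDerivAt_diag_left (a b c : ℝ → ℝ) (y v : ℝ) :
    HasDerivAt (fun s => diag a b c s v) (2 * a v * y + 2 * b v) y := by
  have hid := hasDerivAt_id y
  have := (((hid.pow 2).const_mul (a v)).add (hid.const_mul (2 * b v))).add_const (c v)
  refine this.congr_deriv ?_
  simp only [id]
  norm_num
  ring

/-- The partial derivatives of `log (∂f_n/∂u_{n+1})`. -/
lemma IsFractional.pderiv_logSeparant (hE : IsFractional E O a b c)
    (hI : IsRegularDomain E a b c I) (hu : u ∈ box I) (k : ℤ) :
    pderiv (logSeparant E k) (k - 1) u =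
      (2 * a (u k) * u (k - 1) + 2 * b (u k)) / diag a b c (u (k - 1)) (u k) +
        2 / (u (k + 1) - u (k - 1)) ∧
    pderiv (logSeparant E k) k u =
      diagDeriv a b c (u (k - 1)) (u k) / diag a b c (u (k - 1)) (u k) ∧
    pderiv (logSeparant E k) (k + 1) u = -2 / (u (k + 1) - u (k - 1)) := by
  have h := hI.sub_ne hE hu k
  have hr := hI.diag_ne k _ (hu _) _ (hu _)
  have h1 : k - 1 ≠ k + 1 := by lia
  have h2 : k ≠ k + 1 := by lia
  have h3 : k ≠ k - 1 := by lia
  refine ⟨?_, ?_, ?_⟩ <;>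
    rw [pderiv_congr_box hI.isOpen (fun v hv => hE.logSeparant_eq hI hv k) hu] <;>
    simp only [pderiv, Function.update_self, Function.update_of_ne h1,
      Function.update_of_ne h1.symm,
      Function.update_of_ne h2, Function.update_of_ne h3, Function.update_of_ne h2.symm,
      Function.update_of_ne h3.symm]
  · have d1 := (hasDerivAt_diag_left a b c (u (k - 1)) (u k)).log hr
    have d2 := (((hasDerivAt_id (u (k - 1))).const_sub (u (k + 1))).log h).const_mul 2
    refine (d1.sub d2).deriv.trans ?_
    simp only [id]; ring
  · exact (((hE.hasDerivAt_diag_right (u (k - 1)) (hI.mem hE hu k)).log hr).sub_const _).deriv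
  · have d2 := (((hasDerivAt_id (u (k + 1))).sub_const (u (k - 1))).log h).const_mul 2
    refine (d2.const_sub (Real.log (diag a b c (u (k - 1)) (u k)))).deriv.trans ?_
    simp only [id]; ring

/-- The derivative along the equation of `log (∂f_n/∂u_{n+1})`. -/
lemma IsFractional.flowDeriv_eq (hE : IsFractional E O a b c)
    (hI : IsRegularDomain E a b c I) (hu : u ∈ box I) (k : ℤ) :
    flowDeriv E 1 (logSeparant E k) k u =
      ((2 * a (u k) * u (k - 1) + 2 * b (u k)) / diag a b c (u (k - 1)) (u k) +
        2 / (u (k + 1) - u (k - 1))) * E.rhs (k - 1) u +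
      diagDeriv a b c (u (k - 1)) (u k) / diag a b c (u (k - 1)) (u k) * E.rhs k u +
      -2 / (u (k + 1) - u (k - 1)) * E.rhs (k + 1) u := by
  obtain ⟨h1, h2, h3⟩ := hE.pderiv_logSeparant hI hu k
  have hs : Finset.Icc (k - (1 : ℕ)) (k + (1 : ℕ)) = {k - 1, k, k + 1} := by
    ext j; simp; lia
  rw [flowDeriv, hs, Finset.sum_insert (by simp; lia), Finset.sum_insert (by simp),
    Finset.sum_singleton, h1, h2, h3, add_assoc]

lemma IsFractional.differentiableAt_diag_update (hE : IsFractional E O a b c)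
    (hI : IsLocalDomain E I) (hu : u ∈ box I) (k p : ℤ) :
    DifferentiableAt ℝ (fun s => diag a b c (Function.update u p s (k - 1))
      (Function.update u p s k)) (u p) := by
  have hO := hE.isOpen.mem_nhds (hI.mem hE hu k)
  have hc := fun j => (differentiable_update u p j).differentiableAt (x := u p)
  have key : ∀ h : ℝ → ℝ, ContDiffOn ℝ 2 h O →
      DifferentiableAt ℝ (fun s => h (Function.update u p s k)) (u p) := by
    intro h hh
    refine DifferentiableAt.fun_comp' (u p) ?_ (hc k)
    simpa using (hh.contDiffAt hO).differentiableAt (by norm_num)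
  have ka := key a hE.contDiffOn_a
  have kb := key b hE.contDiffOn_b
  have kc := key c hE.contDiffOn_c
  exact ((ka.mul ((hc (k - 1)).pow 2)).add ((kb.const_mul 2).mul (hc (k - 1)))).add kc

lemma IsFractional.differentiableAt_flowDeriv (hE : IsFractional E O a b c)
    (hI : IsRegularDomain E a b c I) (hu : u ∈ box I) (k p : ℤ) :
    DifferentiableAt ℝ (fun s => flowDeriv E 1 (logSeparant E k) k (Function.update u p s))
      (u p) := by
  have hO := hE.isOpen.mem_nhds (hI.mem hE hu k)
  have hc := fun j => (differentiable_update u p j).differentiableAt (x := u p)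
  have key : ∀ h : ℝ → ℝ, DifferentiableAt ℝ h (u k) →
      DifferentiableAt ℝ (fun s => h (Function.update u p s k)) (u p) := by
    intro h hh
    refine DifferentiableAt.fun_comp' (u p) ?_ (hc k)
    simpa using hh
  have key0 : ∀ h : ℝ → ℝ, ContDiffOn ℝ 2 h O →
      DifferentiableAt ℝ (fun s => h (Function.update u p s k)) (u p) := fun h hh =>
    key h ((hh.contDiffAt hO).differentiableAt (by norm_num))
  have key1 : ∀ h : ℝ → ℝ, ContDiffOn ℝ 2 h O →
      DifferentiableAt ℝ (fun s => deriv h (Function.update u p s k)) (u p) := fun h hh =>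
    key _ (((hh.deriv_of_isOpen (m := 1) hE.isOpen (by norm_num)).contDiffAt hO).differentiableAt
      (by norm_num))
  have hr := hE.differentiableAt_rhs hI.toIsLocalDomain hu
  have hd := hE.differentiableAt_diag_update hI.toIsLocalDomain hu k p
  have hdn : diag a b c (Function.update u p (u p) (k - 1)) (Function.update u p (u p) k) ≠ 0 := by
    simpa using hI.diag_ne k _ (hu _) _ (hu _)
  have hs : Function.update u p (u p) (k + 1) - Function.update u p (u p) (k - 1) ≠ 0 := by
    simpa using hI.sub_ne hE hu k
  have hsd := (hc (k + 1)).sub (hc (k - 1))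
  have hn : DifferentiableAt ℝ (fun s => 2 * a (Function.update u p s k) *
      Function.update u p s (k - 1) + 2 * b (Function.update u p s k)) (u p) :=
    (((key0 a hE.contDiffOn_a).const_mul 2).mul (hc _)).add ((key0 b hE.contDiffOn_b).const_mul 2)
  have hn' : DifferentiableAt ℝ (fun s => diagDeriv a b c (Function.update u p s (k - 1))
      (Function.update u p s k)) (u p) :=
    (((key1 a hE.contDiffOn_a).mul ((hc _).pow 2)).add
      (((key1 b hE.contDiffOn_b).const_mul 2).mul (hc _))).add (key1 c hE.contDiffOn_c)
  refine DifferentiableAt.congr_of_eventuallyEq ?_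
    ((eventually_update_mem_box hI.isOpen hu p).mono fun s hs => hE.flowDeriv_eq hI hs k)
  exact ((((hn.div hd hdn).add ((differentiableAt_const _).div hsd hs)).mul (hr (k - 1) p)).add
    ((hn'.div hd hdn).mul (hr k p))).add
      (((differentiableAt_const _).div hsd hs).mul (hr (k + 1) p))

end Explicit

/-! ### The first condition forces a symmetry of the numerator -/

lemma exists_mem_ne_of_isOpen {s : Set ℝ} (hs : IsOpen s) (hne : s.Nonempty) (x : ℝ) :
    ∃ y ∈ s, y ≠ x := by
  obtain ⟨z, hz⟩ := hne
  obtain ⟨y, hy, hyx⟩ := (infinite_of_mem_nhds z (hs.mem_nhds hz)).exists_notMem_finset {x}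
  exact ⟨y, hy, by simpa using hyx⟩

/-- If the first condition holds, then `R(u_{n+1}, u_n, u_{n+1}) = R(u_n, u_{n+1}, u_n)`.
Up to terms in which `u_{n-1}` and `u_{n+2}` do not occur together, the sum of the functions
`∂_t log (∂f_k/∂u_{k+1})` equals twice
`(R(u_{n-1}, u_n, u_{n+1}) - R(u_n, u_{n+1}, u_{n+2})) / ((u_{n+1} - u_{n-1}) (u_{n+2} - u_n))`;
comparing the variational derivatives at two values of `u_{n+2}` isolates this term. -/
theorem FirstConditionOn.diag_symm {E : VolterraEq} {O : Set ℝ} {a b c : ℝ → ℝ} {I : ℤ → Set ℝ}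
    (hF : FirstConditionOn E I) (hE : IsFractional E O a b c) (hI : IsRegularDomain E a b c I)
    {v x : ℝ} (hv : v ∈ I 1) (hx : x ∈ I 2) : diag a b c x v = diag a b c v x := by
  choose w hw using hI.nonempty
  obtain ⟨u, hu, rfl, rfl⟩ : ∃ u ∈ box I, u 1 = v ∧ u 2 = x :=
    ⟨Function.update (Function.update w 1 v) 2 x,
      update_mem_box (update_mem_box hw hv) hx, by simp, by simp⟩
  obtain ⟨z, hz, hzu⟩ := exists_mem_ne_of_isOpen (hI.isOpen 3) (hI.nonempty 3) (u 3)
  have hu' : Function.update u 3 z ∈ box I := update_mem_box hu hz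
  set u' := Function.update u 3 z with hu'_def
  set A : ℤ → (ℤ → ℝ) → ℝ := fun k => flowDeriv E 1 (logSeparant E k) k with hA
  have hV := hF u hu (hE.pderiv_rhs_ne_zero hI hu) 0
  have hV' := hF u' hu' (hE.pderiv_rhs_ne_zero hI hu') 0
  have hs : Finset.Icc ((0 : ℤ) - (2 : ℕ)) (0 + (2 : ℕ)) = {-2, -1, 0, 1, 2} := by decide
  have hloc : ∀ k : ℤ, k ≤ 0 → pderiv (A k) 0 u' = pderiv (A k) 0 u := fun k hk =>
    ((dependsOn_flowDeriv E k).pderiv 0).update_eq (by simp; lia) u z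
  have hsum :
      pderiv (A 1) 0 u + pderiv (A 2) 0 u - (pderiv (A 1) 0 u' + pderiv (A 2) 0 u') = 0 := by
    simp only [varDeriv, hs] at hV hV'
    change ∑ k ∈ {-2, -1, 0, 1, 2}, pderiv (A k) 0 u = 0 at hV
    change ∑ k ∈ {-2, -1, 0, 1, 2}, pderiv (A k) 0 u' = 0 at hV'
    simp at hV hV'
    rw [hloc (-2) (by lia), hloc (-1) (by lia), hloc 0 le_rfl] at hV'
    linarith
  have h20 : u 2 - u 0 ≠ 0 := by simpa using hI.sub_ne hE hu 1
  have h31 : u 3 - u 1 ≠ 0 := by simpa using hI.sub_ne hE hu 2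
  have hz1 : z - u 1 ≠ 0 := by simpa [u'] using hI.sub_ne hE hu' 2
  have hu0 : u' 0 = u 0 := by simp [u']
  -- the derivative of the combination in `hsum`, computed from the definition
  have hd : HasDerivAt (fun s => A 1 (Function.update u 0 s) + A 2 (Function.update u 0 s) -
      (A 1 (Function.update u' 0 s) + A 2 (Function.update u' 0 s)))
      (pderiv (A 1) 0 u + pderiv (A 2) 0 u - (pderiv (A 1) 0 u' + pderiv (A 2) 0 u')) (u 0) := by
    have d1 := fun k => (hE.differentiableAt_flowDeriv hI hu k 0).hasDerivAt
    have d2 := fun k => (hE.differentiableAt_flowDeriv hI hu' k 0).hasDerivAt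
    rw [hu0] at d2
    have := ((d1 1).add (d1 2)).sub ((d2 1).add (d2 2))
    refine HasDerivAt.congr_deriv this ?_
    simp only [pderiv, hu0, hA]
  -- the same derivative, computed from the explicit formulas
  set F : ℝ → ℝ := fun t =>
    (a (u 2) * (t * u 1) + b (u 2) * (t + u 1) + c (u 2)) / (t - u 1) with hFd
  set δ : ℝ := 1 / (u 3 - u 1) - 1 / (z - u 1) with hδ
  have he : HasDerivAt (fun s => (-2 * (F (u 3) - F z) + 2 * δ *
      ((a (u 1) * u 2 + b (u 1)) * s + (b (u 1) * u 2 + c (u 1)))) / (u 2 - s) +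
      (diagDeriv a b c (u 1) (u 2) / diag a b c (u 1) (u 2) * (F (u 3) - F z) +
        -2 / (u 3 - u 1) * E.rhs 3 u - (-2 / (z - u 1) * E.rhs 3 u')))
      ((-2 * (F (u 3) - F z) + 2 * δ * diag a b c (u 2) (u 1)) / (u 2 - u 0) ^ 2) (u 0) := by
    have hid := hasDerivAt_id (u 0)
    have := (((((hid.const_mul (a (u 1) * u 2 + b (u 1))).add_const
      (b (u 1) * u 2 + c (u 1))).const_mul (2 * δ)).const_add (-2 * (F (u 3) - F z))).div
      (hid.const_sub (u 2)) h20).add_const (diagDeriv a b c (u 1) (u 2) / diag a b c (u 1) (u 2) *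
        (F (u 3) - F z) + -2 / (u 3 - u 1) * E.rhs 3 u - (-2 / (z - u 1) * E.rhs 3 u'))
    refine this.congr_deriv ?_
    simp only [id, diag]
    ring
  have heq : (fun s => A 1 (Function.update u 0 s) + A 2 (Function.update u 0 s) -
      (A 1 (Function.update u' 0 s) + A 2 (Function.update u' 0 s))) =ᶠ[𝓝 (u 0)]
      (fun s => (-2 * (F (u 3) - F z) + 2 * δ *
      ((a (u 1) * u 2 + b (u 1)) * s + (b (u 1) * u 2 + c (u 1)))) / (u 2 - s) +
      (diagDeriv a b c (u 1) (u 2) / diag a b c (u 1) (u 2) * (F (u 3) - F z) +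
        -2 / (u 3 - u 1) * E.rhs 3 u - (-2 / (z - u 1) * E.rhs 3 u'))) := by
    filter_upwards [eventually_update_mem_box hI.isOpen hu 0,
      hu0 ▸ eventually_update_mem_box hI.isOpen hu' 0] with s hs hs'
    simp only [hA, hE.flowDeriv_eq hI hs, hE.flowDeriv_eq hI hs']
    simp only [hE.rhs_eq, hFd, hδ]
    norm_num [u']
    have hs2 : u 2 - s ≠ 0 := by simpa using hI.sub_ne hE hs 1
    ring
  have hfin := (he.congr_of_eventuallyEq heq).unique hd
  rw [hsum, div_eq_zero_iff, or_iff_left (pow_ne_zero 2 h20)] at hfin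
  have hFdiff : F (u 3) - F z = δ * diag a b c (u 1) (u 2) := by
    simp only [hFd, hδ, diag]
    field_simp
    ring
  have hδ0 : δ ≠ 0 := by
    rw [hδ, sub_ne_zero]
    intro h
    rw [div_eq_div_iff h31 hz1] at h
    exact hzu (by linarith)
  rw [hFdiff] at hfin
  have : 2 * δ * (diag a b c (u 2) (u 1) - diag a b c (u 1) (u 2)) = 0 := by linarith
  rw [mul_eq_zero, or_iff_right (mul_ne_zero two_ne_zero hδ0)] at this
  linarith

/-! ### Shrinking local domains -/

lemma quadratic_coeff_eq_zero {s : Set ℝ} (hs : IsOpen s) (hne : s.Nonempty) {p q r : ℝ}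
    (h : ∀ y ∈ s, p * y ^ 2 + q * y + r = 0) : p = 0 ∧ q = 0 ∧ r = 0 := by
  obtain ⟨y₀, h₀⟩ := hne
  have hinf := infinite_of_mem_nhds y₀ (hs.mem_nhds h₀)
  obtain ⟨y₁, h₁, h₁'⟩ := hinf.exists_notMem_finset {y₀}
  obtain ⟨y₂, h₂, h₂'⟩ := hinf.exists_notMem_finset {y₀, y₁}
  simp only [Finset.mem_singleton, Finset.mem_insert, not_or] at h₁' h₂'
  have e₁ : p * (y₁ + y₀) + q = 0 := mul_left_cancel₀ (sub_ne_zero.2 h₁') (by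
    linear_combination h y₁ h₁ - h y₀ h₀)
  have e₂ : p * (y₂ + y₀) + q = 0 := mul_left_cancel₀ (sub_ne_zero.2 h₂'.1) (by
    linear_combination h y₂ h₂ - h y₀ h₀)
  have hp : p = 0 := mul_left_cancel₀ (sub_ne_zero.2 h₂'.2) (by linear_combination e₂ - e₁)
  subst hp
  have hq : q = 0 := by linarith
  subst hq
  exact ⟨rfl, rfl, by simpa using h y₀ h₀⟩

lemma exists_diag_ne_zero {a b c : ℝ → ℝ} {s : Set ℝ} (hs : IsOpen s) (hne : s.Nonempty) {v : ℝ}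
    (hv : a v ≠ 0) : ∃ y ∈ s, diag a b c y v ≠ 0 := by
  by_contra! h
  exact hv (quadratic_coeff_eq_zero hs hne h).1

lemma IsLocalDomain.mono {E : VolterraEq} {I I' : ℤ → Set ℝ} (hI : IsLocalDomain E I)
    (ho : ∀ k, IsOpen (I' k)) (hc : ∀ k, (I' k).OrdConnected) (hne : ∀ k, (I' k).Nonempty)
    (h : ∀ k, I' k ⊆ I k) : IsLocalDomain E I' :=
  ⟨ho, hc, hne, fun u hu => hI.admissible u fun k => h k (hu k)⟩

/-- Every local domain contains a local domain on which the separants have no zeros.  For a suitable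
sequence in the domain the numerators `diag (u_{k-1}) (u_k)` are all nonzero; its terms with even
index are chosen first, and each remaining term is then subject to two open conditions only. -/
theorem IsFractional.exists_isRegularDomain {E : VolterraEq} {O : Set ℝ} {a b c : ℝ → ℝ}
    {I : ℤ → Set ℝ} (hE : IsFractional E O a b c) (hI : IsLocalDomain E I) :
    ∃ I' : ℤ → Set ℝ, (∀ k, I' k ⊆ I k) ∧ IsRegularDomain E a b c I' := by
  choose d hd using hI.nonempty
  have hmem : ∀ k, ∀ x ∈ I k, x ∈ O := fun k x hx => by
    simpa using hI.mem hE (update_mem_box hd hx) k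
  have hcont : ∀ y, ∀ v ∈ O, ContinuousAt (fun q : ℝ × ℝ => diag a b c q.1 q.2) (y, v) := by
    intro y v hv
    have key : ∀ h : ℝ → ℝ, ContDiffOn ℝ 2 h O →
        ContinuousAt (fun q : ℝ × ℝ => h q.2) (y, v) := fun h hh =>
      ContinuousAt.comp' (hh.contDiffAt (hE.isOpen.mem_nhds hv)).continuousAt continuousAt_snd
    exact (((key a hE.contDiffOn_a).mul (continuousAt_fst.pow 2)).add
      (((key b hE.contDiffOn_b).const_mul 2).mul continuousAt_fst)).add (key c hE.contDiffOn_c)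
  have h1 : ∀ k, ∃ y ∈ I k, diag a b c y (d (k + 1)) ≠ 0 := fun k =>
    exists_diag_ne_zero (hI.isOpen k) (hI.nonempty k) (hE.a_ne _ (hmem _ _ (hd (k + 1))))
  choose e he hed using h1
  have h2 : ∀ k, ∃ y ∈ I k, diag a b c (e (k - 1)) y ≠ 0 ∧ diag a b c y (e (k + 1)) ≠ 0 := by
    intro k
    have hk : diag a b c (e (k - 1)) (d k) ≠ 0 := by simpa using hed (k - 1)
    have hc : ContinuousAt (fun s => diag a b c (e (k - 1)) s) (d k) :=
      (hE.hasDerivAt_diag_right (e (k - 1)) (hmem k _ (hd k))).continuousAt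
    obtain ⟨s, hs, hso, hds⟩ := eventually_nhds_iff.1
      ((hc.eventually_ne hk).and ((hI.isOpen k).mem_nhds (hd k)))
    obtain ⟨y, hy, hy'⟩ := exists_diag_ne_zero (b := b) (c := c) hso ⟨_, hds⟩
      (hE.a_ne _ (hmem _ _ (he (k + 1))))
    exact ⟨y, (hs y hy).2, (hs y hy).1, hy'⟩
  choose v hv hv1 hv2 using h2
  obtain ⟨u, hu, hur⟩ : ∃ u ∈ box I, ∀ k, diag a b c (u (k - 1)) (u k) ≠ 0 := by
    refine ⟨fun k => if Even k then e k else v k, fun k => ?_, fun k => ?_⟩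
    · by_cases h : Even k <;> simp [h, he, hv]
    · by_cases h : Even k
      · have : ¬ Even (k - 1) := by grind
        simpa [h, this] using hv2 (k - 1)
      · have : Even (k - 1) := by grind
        simpa [h, this] using hv1 k
  have h3 : ∀ k, ∃ ε > 0, ∀ y w, |y - u (k - 1)| < ε → |w - u k| < ε → diag a b c y w ≠ 0 := by
    intro k
    obtain ⟨ε, hε, h⟩ := Metric.eventually_nhds_iff.1
      ((hcont (u (k - 1)) (u k) (hmem k _ (hu k))).eventually_ne (hur k))
    exact ⟨ε, hε, fun y w hy hw => h (y := (y, w)) (by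
      rw [Prod.dist_eq, Real.dist_eq, Real.dist_eq]; exact max_lt hy hw)⟩
  choose ε hε hdiag using h3
  let r : ℤ → ℝ := fun k => min (ε k) (ε (k + 1))
  have hr : ∀ k, 0 < r k := fun k => lt_min (hε k) (hε _)
  refine ⟨fun k => I k ∩ Metric.ball (u k) (r k), fun k => Set.inter_subset_left,
    hI.mono (fun k => (hI.isOpen k).inter Metric.isOpen_ball) (fun k => ?_)
      (fun k => ⟨u k, hu k, Metric.mem_ball_self (hr k)⟩) fun k => Set.inter_subset_left,
    fun k y hy w hw => ?_⟩
  · rw [Real.ball_eq_Ioo]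
    exact (hI.ordConnected k).inter Set.ordConnected_Ioo
  · have hy' : |y - u (k - 1)| < r (k - 1) := hy.2
    have hw' : |w - u k| < r k := hw.2
    refine hdiag k y w (hy'.trans_le ?_) (hw'.trans_le (min_le_left _ _))
    exact (min_le_right _ _).trans_eq (by rw [sub_add_cancel])

/-! ### The three equations -/

lemma deriv_eq_on_of_isOpen {W : Set ℝ} (hW : IsOpen W) {f g f' g' : ℝ → ℝ}
    (h : ∀ x ∈ W, f x = g x) (hf : ∀ x ∈ W, HasDerivAt f (f' x) x)
    (hg : ∀ x ∈ W, HasDerivAt g (g' x) x) : ∀ x ∈ W, f' x = g' x := fun x hx =>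
  (hf x hx).unique ((hg x hx).congr_of_eventuallyEq
    (by filter_upwards [hW.mem_nhds hx] with y hy using h y hy))

/-- If `R(x, u, x) = R(u, x, u)` on a product of open sets, then the leading coefficient of
`R(y, u, y)` in `y` is locally a quadratic polynomial; so its third derivative vanishes. -/
lemma third_deriv_eq_zero_of_diag_symm {a b c : ℝ → ℝ} {U W : Set ℝ} (hU : IsOpen U)
    (hUne : U.Nonempty) (hW : IsOpen W)
    (h : ∀ u ∈ U, ∀ x ∈ W, diag a b c x u = diag a b c u x) {a₁ a₂ a₃ : ℝ → ℝ}
    (h₁ : ∀ x ∈ W, HasDerivAt a (a₁ x) x) (h₂ : ∀ x ∈ W, HasDerivAt a₁ (a₂ x) x)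
    (h₃ : ∀ x ∈ W, HasDerivAt a₂ (a₃ x) x) : ∀ x ∈ W, a₃ x = 0 := by
  obtain ⟨u₀, hu₀⟩ := hUne
  have hinf := infinite_of_mem_nhds u₀ (hU.mem_nhds hu₀)
  obtain ⟨u₁, hu₁, h01⟩ := hinf.exists_notMem_finset {u₀}
  obtain ⟨u₂, hu₂, h02⟩ := hinf.exists_notMem_finset {u₀, u₁}
  simp only [Finset.mem_singleton, Finset.mem_insert, not_or] at h01 h02
  have d1 := sub_ne_zero.2 h01
  have d2 := sub_ne_zero.2 h02.1
  have d3 := sub_ne_zero.2 h02.2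
  -- the second divided difference in `u` of `diag a b c u x` is `a x`
  let D : (ℝ → ℝ) → ℝ := fun f =>
    ((f u₂ - f u₀) / (u₂ - u₀) - (f u₁ - f u₀) / (u₁ - u₀)) / (u₂ - u₁)
  have hq : ∀ x ∈ W, a x = D a * x ^ 2 + D (fun t => 2 * b t) * x + D c := by
    intro x hx
    have e0 := h u₀ hu₀ x hx
    have e1 := h u₁ hu₁ x hx
    have e2 := h u₂ hu₂ x hx
    have hD : D (fun t => diag a b c t x) = D (fun t => diag a b c x t) := by
      simp only [D, e0, e1, e2]
    have hl : D (fun t => diag a b c t x) = a x := by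
      simp only [D, diag]
      field_simp
      ring
    rw [← hl, hD]
    simp only [D, diag]
    ring
  have q1 : ∀ x ∈ W, a₁ x = D a * (2 * x) + D (fun t => 2 * b t) :=
    deriv_eq_on_of_isOpen hW hq h₁ fun x _ => by
      have := ((((hasDerivAt_id x).pow 2).const_mul (D a)).add
        ((hasDerivAt_id x).const_mul (D (fun t => 2 * b t)))).add_const (D c)
      refine this.congr_deriv ?_
      norm_num
  have q2 : ∀ x ∈ W, a₂ x = D a * 2 :=
    deriv_eq_on_of_isOpen hW q1 h₂ fun x _ => by
      have := (((hasDerivAt_id x).const_mul 2).const_mul (D a)).add_const (D (fun t => 2 * b t))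
      exact this.congr_deriv (by ring)
  exact deriv_eq_on_of_isOpen hW q2 h₃ fun x _ => hasDerivAt_const _ _

lemma contDiff_exp_arctan (ρ : ℝ) :
    ContDiff ℝ 2 fun u : ℝ => Real.exp (ρ * Real.arctan u) * (1 + u ^ 2) :=
  (contDiff_const.mul Real.contDiff_arctan).exp.mul (by fun_prop)

lemma isFractional_eqArctan (ρ : ℝ) : IsFractional (eqArctan ρ) Set.univ
    (fun u => Real.exp (ρ * Real.arctan u) * (1 + u ^ 2)) (fun _ => 0)
    (fun u => Real.exp (ρ * Real.arctan u) * (1 + u ^ 2)) where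
  f_eq y u x := by simp only [eqArctan]; ring
  isOpen := isOpen_univ
  contDiffOn_a := (contDiff_exp_arctan ρ).contDiffOn
  contDiffOn_b := by fun_prop
  contDiffOn_c := (contDiff_exp_arctan ρ).contDiffOn
  a_ne u _ := by positivity
  dom_symm _ _ _ h := Ne.symm h
  dom_ne _ _ _ h := h
  dom_mem _ _ _ _ := trivial

lemma isFractional_eqExp (A : ℝ) : IsFractional (eqExp A) Set.univ Real.exp
    (fun u => Real.exp u * (A - u)) (fun u => Real.exp u * (u ^ 2 - 2 * A * u)) where
  f_eq y u x := by simp only [eqExp]; ring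
  isOpen := isOpen_univ
  contDiffOn_a := by fun_prop
  contDiffOn_b := by fun_prop
  contDiffOn_c := by fun_prop
  a_ne u _ := Real.exp_ne_zero u
  dom_symm _ _ _ h := Ne.symm h
  dom_ne _ _ _ h := h
  dom_mem _ _ _ _ := trivial

/-- The admissible values of `u_n` for the equation with the factor `u_n ^ ρ`. -/
def powerDomain (ρ : ℝ) : Set ℝ := {u | 0 < u ∨ (u < 0 ∧ ∃ m : ℤ, ρ = m)}

lemma ne_zero_of_mem_powerDomain {ρ u : ℝ} (hu : u ∈ powerDomain ρ) : u ≠ 0 := by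
  rcases hu with h | h
  · exact h.ne'
  · exact h.1.ne

lemma isOpen_powerDomain (ρ : ℝ) : IsOpen (powerDomain ρ) :=
  (isOpen_lt continuous_const continuous_id).union
    ((isOpen_lt continuous_id continuous_const).inter isOpen_const)

lemma rpow_ne_zero_of_mem_powerDomain {ρ u : ℝ} (hu : u ∈ powerDomain ρ) (j : ℤ) :
    u ^ (ρ - j) ≠ 0 := by
  have h0 := ne_zero_of_mem_powerDomain hu
  rcases hu with h | ⟨-, m, rfl⟩
  · exact (Real.rpow_pos_of_pos h _).ne'
  · rw [← Int.cast_sub, Real.rpow_intCast]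
    exact zpow_ne_zero _ h0

lemma isFractional_eqPower (ρ A B : ℝ) : IsFractional (eqPower ρ A B) (powerDomain ρ)
    (fun u => u ^ ρ) (fun u => u ^ ρ * (A * u)) (fun u => u ^ ρ * (B * u ^ 2)) := by
  have hp : ContDiffOn ℝ 2 (fun u : ℝ => u ^ ρ) (powerDomain ρ) := fun u hu =>
    (Real.contDiffAt_rpow_const_of_ne (ne_zero_of_mem_powerDomain hu)).contDiffWithinAt
  exact {
    f_eq := fun y u x => by simp only [eqPower]; ring
    isOpen := isOpen_powerDomain ρ
    contDiffOn_a := hp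
    contDiffOn_b := hp.mul (by fun_prop)
    contDiffOn_c := hp.mul (by fun_prop)
    a_ne := fun u hu => by simpa using rpow_ne_zero_of_mem_powerDomain hu 0
    dom_symm := fun _ _ _ h => ⟨h.1.symm, h.2⟩
    dom_ne := fun _ _ _ h => h.1
    dom_mem := fun _ _ _ h => h.2 }

lemma not_diag_symm_eqArctan {ρ : ℝ} (hρ : ρ ≠ 0) {U W : Set ℝ} (hW : IsOpen W)
    (hUne : U.Nonempty) (hWne : W.Nonempty) :
    ¬ ∀ u ∈ U, ∀ x ∈ W,
      diag (fun u => Real.exp (ρ * Real.arctan u) * (1 + u ^ 2)) (fun _ => 0)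
        (fun u => Real.exp (ρ * Real.arctan u) * (1 + u ^ 2)) x u =
      diag (fun u => Real.exp (ρ * Real.arctan u) * (1 + u ^ 2)) (fun _ => 0)
        (fun u => Real.exp (ρ * Real.arctan u) * (1 + u ^ 2)) u x := by
  intro h
  obtain ⟨u, hu⟩ := hUne
  obtain ⟨x, hx, hxu⟩ := exists_mem_ne_of_isOpen hW hWne u
  have h1 := h u hu x hx
  simp only [diag] at h1
  have h2 : Real.exp (ρ * Real.arctan u) = Real.exp (ρ * Real.arctan x) := by
    have : (1 + u ^ 2) * (1 + x ^ 2) ≠ 0 := by positivity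
    refine mul_right_cancel₀ this ?_
    linear_combination h1
  exact hxu (Real.arctan_injective (mul_left_cancel₀ hρ (Real.exp_injective h2))).symm

lemma not_diag_symm_eqExp {A : ℝ} {U W : Set ℝ} (hU : IsOpen U) (hW : IsOpen W)
    (hUne : U.Nonempty) (hWne : W.Nonempty) :
    ¬ ∀ u ∈ U, ∀ x ∈ W,
      diag Real.exp (fun u => Real.exp u * (A - u))
        (fun u => Real.exp u * (u ^ 2 - 2 * A * u)) x u =
      diag Real.exp (fun u => Real.exp u * (A - u))
        (fun u => Real.exp u * (u ^ 2 - 2 * A * u)) u x := by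
  intro h
  obtain ⟨x, hx⟩ := hWne
  have he : ∀ x ∈ W, HasDerivAt Real.exp (Real.exp x) x := fun x _ => Real.hasDerivAt_exp x
  exact Real.exp_ne_zero x (third_deriv_eq_zero_of_diag_symm hU hUne hW h he he he x hx)

lemma not_diag_symm_eqPower {ρ A B : ℝ} (hρ : ρ ≠ 0) (h1 : ¬ (ρ = 1 ∧ A = 1 / 2 ∧ B = 0))
    (h2 : ¬ (ρ = 2 ∧ A = 0 ∧ B = 0)) {U W : Set ℝ} (hU : IsOpen U) (hW : IsOpen W)
    (hUne : U.Nonempty) (hWne : W.Nonempty) (hU0 : U ⊆ powerDomain ρ) (hW0 : W ⊆ powerDomain ρ) :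
    ¬ ∀ u ∈ U, ∀ x ∈ W,
      diag (fun u => u ^ ρ) (fun u => u ^ ρ * (A * u)) (fun u => u ^ ρ * (B * u ^ 2)) x u =
      diag (fun u => u ^ ρ) (fun u => u ^ ρ * (A * u)) (fun u => u ^ ρ * (B * u ^ 2)) u x := by
  intro h
  have hd : ∀ (r : ℝ), ∀ x ∈ W, HasDerivAt (fun x : ℝ => x ^ r) (r * x ^ (r - 1)) x :=
    fun r x hx => Real.hasDerivAt_rpow_const (Or.inl (ne_zero_of_mem_powerDomain (hW0 hx)))
  obtain ⟨x₀, hx₀⟩ := hWne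
  have h3 := third_deriv_eq_zero_of_diag_symm hU hUne hW h (hd ρ)
    (fun x hx => (hd (ρ - 1) x hx).const_mul ρ)
    (fun x hx => ((hd (ρ - 1 - 1) x hx).const_mul (ρ - 1)).const_mul ρ) x₀ hx₀
  have h4 : x₀ ^ (ρ - 1 - 1 - 1) ≠ 0 := by
    have := rpow_ne_zero_of_mem_powerDomain (hW0 hx₀) 3
    convert this using 2
    push_cast
    ring
  have h5 : (ρ - 1) * (ρ - 2) = 0 := by
    refine mul_right_cancel₀ h4 (mul_left_cancel₀ hρ ?_)
    linear_combination h3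
  obtain ⟨u, hu, hux⟩ := exists_mem_ne_of_isOpen hU hUne x₀
  have hu0 := ne_zero_of_mem_powerDomain (hU0 hu)
  simp only [diag] at h
  rcases mul_eq_zero.1 h5 with h6 | h6
  · obtain rfl : ρ = 1 := by linarith
    simp only [Real.rpow_one] at h
    -- a cubic identity in `x`, divided by `x - u`
    have hW' : IsOpen (W \ {u}) := hW.sdiff isClosed_singleton
    have := quadratic_coeff_eq_zero (p := -B) (q := u * (1 - 2 * A - B)) (r := -(B * u ^ 2)) hW'
      ⟨x₀, hx₀, fun h => hux h.symm⟩ (fun x hx => by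
        refine mul_left_cancel₀ (sub_ne_zero.2 (show x ≠ u from hx.2)) ?_
        linear_combination h u hu x hx.1)
    have hB : B = 0 := by linarith [this.1]
    have := (mul_eq_zero.1 this.2.1).resolve_left hu0
    exact h1 ⟨rfl, by linarith, hB⟩
  · obtain rfl : ρ = 2 := by linarith
    simp only [Real.rpow_two] at h
    have hW' : IsOpen (W \ {u, -u}) := hW.sdiff (Set.toFinite _).isClosed
    obtain ⟨x₁, hx₁, hx₁'⟩ :=
      (infinite_of_mem_nhds x₀ (hW.mem_nhds hx₀)).exists_notMem_finset {u, -u}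
    have := quadratic_coeff_eq_zero (p := B) (q := 2 * A * u) (r := B * u ^ 2) hW'
      ⟨x₁, hx₁, by simpa using hx₁'⟩ (fun x hx => by
        have hx' := hx.2
        simp only [Set.mem_insert_iff, Set.mem_singleton_iff, not_or] at hx'
        have e1 : u - x ≠ 0 := sub_ne_zero.2 (Ne.symm hx'.1)
        have e2 : u + x ≠ 0 := fun h => hx'.2 (by linarith)
        refine mul_left_cancel₀ (mul_ne_zero e1 e2) ?_
        linear_combination h u hu x hx.1)
    have hA := (mul_eq_zero.1 this.2.1).resolve_right hu0
    exact h2 ⟨rfl, by linarith, this.1⟩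

/-! ### Smooth functions of finitely many variables -/

section Smooth

variable {N : ℕ} {G : ℤ → ℝ × Window N → ℝ}

/-- The direction in the space `(t, u_{n-N}, …, u_{n+N})` corresponding to the variable `u_k`; it is
zero if `u_k` does not occur. -/
def windowDir (N : ℕ) (n k : ℤ) : ℝ × Window N := (0, fun i => if n + i = k then 1 else 0)

lemma window_update (N : ℕ) (n k : ℤ) (t : ℝ) (u : ℤ → ℝ) (s : ℝ) :
    (t, window N n (Function.update u k s)) =
      (t, window N n u) + (s - u k) • windowDir N n k := by
  refine Prod.ext (by simp [windowDir]) ?_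
  funext i
  by_cases h : n + (i : ℤ) = k
  · simp [window, windowDir, h]
  · simp [window, windowDir, h]

lemma dependsOn_onSeq (G : ℤ → ℝ × Window N → ℝ) (n : ℤ) (t : ℝ) :
    DependsOn (onSeq G n t) (Set.Icc (n - N) (n + N)) := by
  intro u v h
  have : window N n u = window N n v := by
    funext i
    have := Finset.mem_Icc.1 i.2
    exact h _ (by simp only [Set.mem_Icc]; lia)
  simp [onSeq, this]

lemma hasDerivAt_line {V F : Type*} [NormedAddCommGroup V] [NormedSpace ℝ V]
    [NormedAddCommGroup F] [NormedSpace ℝ F] {H : V → F} {x : V} (hH : DifferentiableAt ℝ H x)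
    (e : V) (s₀ : ℝ) :
    HasDerivAt (fun s : ℝ => H (x + (s - s₀) • e)) (fderiv ℝ H x e) s₀ := by
  have h1 : HasDerivAt (fun s : ℝ => x + (s - s₀) • e) e s₀ := by
    simpa using (((hasDerivAt_id s₀).sub_const s₀).smul_const e).const_add x
  have h2 : HasFDerivAt H (fderiv ℝ H x) (x + (s₀ - s₀) • e) := by simpa using hH.hasFDerivAt
  exact h2.comp_hasDerivAt s₀ h1

end Smooth

/-! ### The linearized equation -/

namespace IsGeneralizedSymmetry

variable {E : VolterraEq} {J : Set ℝ} {I : ℤ → Set ℝ} {N : ℕ} {G : ℤ → ℝ × Window N → ℝ}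
  {t : ℝ} {u : ℤ → ℝ}

lemma mono (hG : IsGeneralizedSymmetry E J I G) {I' : ℤ → Set ℝ} (h : ∀ k, I' k ⊆ I k) :
    IsGeneralizedSymmetry E J I' G where
  smooth n := (hG.smooth n).mono (Set.prod_mono_right fun _ hw k => h _ (hw k))
  determining n t ht u hu := hG.determining n t ht u fun k => h k (hu k)

lemma contDiffAt (hG : IsGeneralizedSymmetry E J I G) (hJ : IsOpen J) (hI : ∀ k, IsOpen (I k))
    (ht : t ∈ J) (hu : u ∈ box I) (n : ℤ) : ContDiffAt ℝ ∞ (G n) (t, window N n u) := by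
  refine (hG.smooth n).contDiffAt (IsOpen.mem_nhds (hJ.prod ?_) ⟨ht, fun k => hu _⟩)
  rw [Set.ofPred_forall]
  exact isOpen_iInter_of_finite fun k => (hI _).preimage (continuous_apply k)

lemma hasDerivAt (hG : IsGeneralizedSymmetry E J I G) (hJ : IsOpen J) (hI : ∀ k, IsOpen (I k))
    (ht : t ∈ J) (hu : u ∈ box I) (n k : ℤ) :
    HasDerivAt (fun s => onSeq G n t (Function.update u k s))
      (fderiv ℝ (G n) (t, window N n u) (windowDir N n k)) (u k) := by
  simp only [onSeq, window_update]
  exact hasDerivAt_line ((hG.contDiffAt hJ hI ht hu n).differentiableAt (by norm_num)) _ _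

lemma pderiv_eq (hG : IsGeneralizedSymmetry E J I G) (hJ : IsOpen J) (hI : ∀ k, IsOpen (I k))
    (ht : t ∈ J) (hu : u ∈ box I) (n k : ℤ) :
    pderiv (onSeq G n t) k u = fderiv ℝ (G n) (t, window N n u) (windowDir N n k) :=
  (hG.hasDerivAt hJ hI ht hu n k).deriv

lemma hasDerivAt_time (hG : IsGeneralizedSymmetry E J I G) (hJ : IsOpen J)
    (hI : ∀ k, IsOpen (I k)) (ht : t ∈ J) (hu : u ∈ box I) (n : ℤ) :
    HasDerivAt (fun s => onSeq G n s u) (fderiv ℝ (G n) (t, window N n u) (1, 0)) t := by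
  have := hasDerivAt_line ((hG.contDiffAt hJ hI ht hu n).differentiableAt (by norm_num)) (1, 0) t
  simpa [onSeq] using this

lemma fderiv_differentiableAt (hG : IsGeneralizedSymmetry E J I G) (hJ : IsOpen J)
    (hI : ∀ k, IsOpen (I k)) (ht : t ∈ J) (hu : u ∈ box I) (n : ℤ) :
    DifferentiableAt ℝ (fderiv ℝ (G n)) (t, window N n u) :=
  ((hG.contDiffAt hJ hI ht hu n).fderiv_right (m := 1) (by norm_cast)).differentiableAt
    (by norm_num)

lemma fderiv_fderiv_comm (hG : IsGeneralizedSymmetry E J I G) (hJ : IsOpen J)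
    (hI : ∀ k, IsOpen (I k)) (ht : t ∈ J) (hu : u ∈ box I) (n : ℤ) (d e : ℝ × Window N) :
    fderiv ℝ (fderiv ℝ (G n)) (t, window N n u) d e =
      fderiv ℝ (fderiv ℝ (G n)) (t, window N n u) e d :=
  ((hG.contDiffAt hJ hI ht hu n).isSymmSndFDerivAt (by simp; norm_cast)).eq d e

lemma hasDerivAt_fderiv_update (hG : IsGeneralizedSymmetry E J I G) (hJ : IsOpen J)
    (hI : ∀ k, IsOpen (I k)) (ht : t ∈ J) (hu : u ∈ box I) (n p : ℤ) (e : ℝ × Window N) :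
    HasDerivAt (fun s => fderiv ℝ (G n) (t, window N n (Function.update u p s)) e)
      (fderiv ℝ (fderiv ℝ (G n)) (t, window N n u) (windowDir N n p) e) (u p) := by
  simp only [window_update]
  exact ((hasDerivAt_line (hG.fderiv_differentiableAt hJ hI ht hu n) (windowDir N n p)
    (u p)).clm_apply (hasDerivAt_const _ e)).congr_deriv (by simp)

/-- Second partial derivatives with respect to the variables `u_k` commute. -/
lemma hasDerivAt_pderiv (hG : IsGeneralizedSymmetry E J I G) (hJ : IsOpen J)
    (hI : ∀ k, IsOpen (I k)) (ht : t ∈ J) (hu : u ∈ box I) (n k p : ℤ) :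
    HasDerivAt (fun s => pderiv (onSeq G n t) k (Function.update u p s))
      (pderiv (pderiv (onSeq G n t) p) k u) (u p) := by
  have h1 := hG.hasDerivAt_fderiv_update hJ hI ht hu n p (windowDir N n k)
  have h2 := hG.hasDerivAt_fderiv_update hJ hI ht hu n k (windowDir N n p)
  rw [hG.fderiv_fderiv_comm hJ hI ht hu, ← h2.deriv] at h1
  have h3 : pderiv (pderiv (onSeq G n t) p) k u =
      deriv (fun s => fderiv ℝ (G n) (t, window N n (Function.update u k s)) (windowDir N n p))
        (u k) := by
    refine Filter.EventuallyEq.deriv_eq ?_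
    filter_upwards [eventually_update_mem_box hI hu k] with s hs
      using hG.pderiv_eq hJ hI ht hs n p
  rw [h3]
  refine h1.congr_of_eventuallyEq ?_
  filter_upwards [eventually_update_mem_box hI hu p] with s hs using hG.pderiv_eq hJ hI ht hs n k

/-- The partial derivatives with respect to `t` and `u_p` commute. -/
lemma hasDerivAt_deriv_time (hG : IsGeneralizedSymmetry E J I G) (hJ : IsOpen J)
    (hI : ∀ k, IsOpen (I k)) (ht : t ∈ J) (hu : u ∈ box I) (n p : ℤ) :
    HasDerivAt (fun s => deriv (fun τ => onSeq G n τ (Function.update u p s)) t)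
      (deriv (fun τ => pderiv (onSeq G n τ) p u) t) (u p) := by
  have h1 := hG.hasDerivAt_fderiv_update hJ hI ht hu n p (1, 0)
  have h2 : HasDerivAt (fun τ => fderiv ℝ (G n) (τ, window N n u) (windowDir N n p))
      (fderiv ℝ (fderiv ℝ (G n)) (t, window N n u) (1, 0) (windowDir N n p)) t := by
    have := ((hasDerivAt_line (hG.fderiv_differentiableAt hJ hI ht hu n) (1, 0)
      t).clm_apply (hasDerivAt_const _ (windowDir N n p))).congr_deriv (by simp; rfl)
    simpa using this
  have h3 : deriv (fun τ => pderiv (onSeq G n τ) p u) t =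
      fderiv ℝ (fderiv ℝ (G n)) (t, window N n u) (1, 0) (windowDir N n p) := by
    rw [← h2.deriv]
    refine Filter.EventuallyEq.deriv_eq ?_
    filter_upwards [hJ.mem_nhds ht] with τ hτ using hG.pderiv_eq hJ hI hτ hu n p
  rw [h3, ← hG.fderiv_fderiv_comm hJ hI ht hu]
  refine h1.congr_of_eventuallyEq ?_
  filter_upwards [eventually_update_mem_box hI hu p] with s hs
    using (hG.hasDerivAt_time hJ hI ht hs n).deriv

/-- The determining equation differentiated with respect to `u_p`, where `f_n` does not depend on
`u_p` because `p ≥ n + 2`. -/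
lemma linearized (hG : IsGeneralizedSymmetry E J I G) (hJ : IsOpen J) {O : Set ℝ} {a b c : ℝ → ℝ}
    (hE : IsFractional E O a b c) (hI : IsLocalDomain E I) (ht : t ∈ J) (hu : u ∈ box I) {n p : ℤ}
    (hp : n + 2 ≤ p) :
    deriv (fun τ => pderiv (onSeq G n τ) p u) t +
      ∑ k ∈ Finset.Icc (n - (N : ℤ)) (n + N), (pderiv (pderiv (onSeq G n t) p) k u * E.rhs k u +
        pderiv (onSeq G n t) k u * pderiv (E.rhs k) p u) =
      ∑ k ∈ Finset.Icc (n - 1) (n + 1), pderiv (E.rhs n) k u * pderiv (onSeq G k t) p u := by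
  have hl : HasDerivAt (fun s => deriv (fun τ => onSeq G n τ (Function.update u p s)) t +
      flowDeriv E N (onSeq G n t) n (Function.update u p s))
      (deriv (fun τ => pderiv (onSeq G n τ) p u) t +
      ∑ k ∈ Finset.Icc (n - (N : ℤ)) (n + N), (pderiv (pderiv (onSeq G n t) p) k u * E.rhs k u +
        pderiv (onSeq G n t) k u * pderiv (E.rhs k) p u)) (u p) := by
    refine (hG.hasDerivAt_deriv_time hJ hI.isOpen ht hu n p).add ?_
    simp only [flowDeriv]
    refine HasDerivAt.fun_sum fun k _ => ?_
    have := (hG.hasDerivAt_pderiv hJ hI.isOpen ht hu n k p).mul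
      (hE.differentiableAt_rhs hI hu k p).hasDerivAt
    simp only [Function.update_eq_self] at this
    exact this
  have hr : HasDerivAt (fun s => ∑ k ∈ Finset.Icc (n - 1) (n + 1),
      pderiv (E.rhs n) k (Function.update u p s) * onSeq G k t (Function.update u p s))
      (∑ k ∈ Finset.Icc (n - 1) (n + 1), pderiv (E.rhs n) k u * pderiv (onSeq G k t) p u)
      (u p) := by
    refine HasDerivAt.fun_sum fun k _ => ?_
    have h1 : ∀ s, pderiv (E.rhs n) k (Function.update u p s) = pderiv (E.rhs n) k u :=
      ((dependsOn_rhs E n).pderiv k).update_eq (by simp; lia) u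
    simp only [h1]
    rw [hG.pderiv_eq hJ hI.isOpen ht hu]
    exact (hG.hasDerivAt hJ hI.isOpen ht hu k p).const_mul _
  refine hl.unique (hr.congr_of_eventuallyEq ?_)
  filter_upwards [eventually_update_mem_box hI.isOpen hu p] with s hs
    using hG.determining n t ht _ hs

end IsGeneralizedSymmetry

/-! ### A symmetry of positive order implies the first condition -/

/-- The product `∏_{i < l} ∂f_{n+i}/∂u_{n+i+1}` of separants. -/
noncomputable def sepProd (E : VolterraEq) (l : ℕ) (n : ℤ) (u : ℤ → ℝ) : ℝ :=
  ∏ i ∈ Finset.range l, pderiv (E.rhs (n + i)) (n + i + 1) u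

lemma sepProd_succ (E : VolterraEq) (l : ℕ) (n : ℤ) (u : ℤ → ℝ) :
    sepProd E (l + 1) n u = sepProd E l n u * pderiv (E.rhs (n + l)) (n + l + 1) u :=
  Finset.prod_range_succ _ _

lemma sepProd_succ' (E : VolterraEq) (l : ℕ) (n : ℤ) (u : ℤ → ℝ) :
    sepProd E (l + 1) n u = pderiv (E.rhs n) (n + 1) u * sepProd E l (n + 1) u := by
  rw [sepProd, Finset.prod_range_succ', mul_comm]
  simp only [sepProd, Nat.cast_add, Nat.cast_one, Nat.cast_zero, add_zero]
  congr 1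
  refine Finset.prod_congr rfl fun i _ => ?_
  rw [show n + ((i : ℤ) + 1) = n + 1 + i by ring]

lemma dependsOn_sepProd (E : VolterraEq) (l : ℕ) (n : ℤ) :
    DependsOn (sepProd E l n) (Set.Icc (n - 1) (n + l)) := by
  intro u v h
  refine Finset.prod_congr rfl fun i hi => ?_
  have := Finset.mem_range.1 hi
  exact (dependsOn_rhs E _).pderiv _ fun j hj => h j (by simp only [Set.mem_Icc] at hj ⊢; lia)

section

variable {E : VolterraEq} {O : Set ℝ} {a b c : ℝ → ℝ} {J : Set ℝ} {I : ℤ → Set ℝ} {N : ℕ}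
  {G : ℤ → ℝ × Window N → ℝ} {t : ℝ} {u : ℤ → ℝ} {m : ℕ}

lemma IsFractional.sepProd_ne_zero (hE : IsFractional E O a b c) (hI : IsRegularDomain E a b c I)
    (hu : u ∈ box I) (l : ℕ) (n : ℤ) : sepProd E l n u ≠ 0 :=
  Finset.prod_ne_zero_iff.2 fun _ _ => hE.pderiv_rhs_ne_zero hI hu _

lemma IsFractional.hasDerivAt_pderiv_rhs_succ (hE : IsFractional E O a b c)
    (hI : IsRegularDomain E a b c I) (hu : u ∈ box I) (n k : ℤ) :
    HasDerivAt (fun s => pderiv (E.rhs n) (n + 1) (Function.update u k s))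
      (pderiv (E.rhs n) (n + 1) u * pderiv (logSeparant E n) k u) (u k) := by
  have h0 := hE.pderiv_rhs_ne_zero hI hu n
  have hd :
      DifferentiableAt ℝ (fun s => pderiv (E.rhs n) (n + 1) (Function.update u k s)) (u k) := by
    refine DifferentiableAt.congr_of_eventuallyEq ?_
      ((eventually_update_mem_box hI.isOpen hu k).mono fun s hs =>
        hE.pderiv_rhs_succ n (hI.sub_ne hE hs n))
    have hc := fun j => (differentiable_update u k j).differentiableAt (x := u k)
    exact ((hE.differentiableAt_diag_update hI.toIsLocalDomain hu n k).neg).div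
      (((hc _).sub (hc _)).pow 2) (by simpa using hI.sub_ne hE hu n)
  refine hd.hasDerivAt.congr_deriv ?_
  have := (hd.hasDerivAt.log (by simpa using h0)).deriv
  simp only [Function.update_eq_self] at this
  simp only [pderiv, logSeparant] at this h0 ⊢
  rw [this]
  field_simp

lemma IsFractional.pderiv_sepProd (hE : IsFractional E O a b c) (hI : IsRegularDomain E a b c I)
    (hu : u ∈ box I) (l : ℕ) (n k : ℤ) :
    pderiv (sepProd E l n) k u =
      sepProd E l n u * ∑ i ∈ Finset.range l, pderiv (logSeparant E (n + i)) k u := by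
  suffices h : HasDerivAt (fun s => sepProd E l n (Function.update u k s))
      (sepProd E l n u * ∑ i ∈ Finset.range l, pderiv (logSeparant E (n + i)) k u) (u k)
    from h.deriv
  induction l with
  | zero => simpa [sepProd] using hasDerivAt_const (u k) (1 : ℝ)
  | succ l ih =>
    simp only [sepProd_succ, Finset.sum_range_succ]
    refine (ih.mul (hE.hasDerivAt_pderiv_rhs_succ hI hu (n + l) k)).congr_deriv ?_
    simp only [Function.update_eq_self]
    ring

/-- No function `g_n` of the family depends on a variable `u_{n+j}` with `j > m`. -/
def OrderLE (J : Set ℝ) (I : ℤ → Set ℝ) (G : ℤ → ℝ × Window N → ℝ) (m : ℕ) : Prop :=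
  ∀ n, ∀ t ∈ J, ∀ u ∈ box I, ∀ p : ℤ, n + m < p → pderiv (onSeq G n t) p u = 0

lemma OrderLE.pderiv_pderiv (hm : OrderLE J I G m) (hI : ∀ k, IsOpen (I k)) (ht : t ∈ J)
    (hu : u ∈ box I) {n p : ℤ} (hp : n + m < p) (k : ℤ) :
    pderiv (pderiv (onSeq G n t) p) k u = 0 := by
  rw [pderiv_congr_box hI (g := fun _ => 0) (fun v hv => hm n t ht v hv p hp) hu]
  simp [pderiv]

/-- The relation between the leading coefficients `∂g_n/∂u_{n+m}`. -/
lemma IsGeneralizedSymmetry.leading_rel (hG : IsGeneralizedSymmetry E J I G) (hJ : IsOpen J)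
    (hE : IsFractional E O a b c) (hI : IsLocalDomain E I) (hm : OrderLE J I G m) (hm2 : 2 ≤ m)
    (hmN : m ≤ N) (ht : t ∈ J) (hu : u ∈ box I) (n : ℤ) :
    pderiv (onSeq G n t) (n + m) u * pderiv (E.rhs (n + m)) (n + m + 1) u =
      pderiv (E.rhs n) (n + 1) u * pderiv (onSeq G (n + 1) t) (n + 1 + m) u := by
  have h := hG.linearized hJ hE hI ht hu (n := n) (p := n + m + 1) (by lia)
  have h1 : deriv (fun τ => pderiv (onSeq G n τ) (n + m + 1) u) t = 0 := by
    refine (Filter.EventuallyEq.deriv_eq (f := fun _ => (0 : ℝ)) ?_).trans (by simp)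
    filter_upwards [hJ.mem_nhds ht] with τ hτ using hm n τ hτ u hu _ (by lia)
  rw [h1, zero_add, Finset.sum_eq_single (n + m), hm.pderiv_pderiv hI.isOpen ht hu (by lia),
    Finset.sum_eq_single (n + 1)] at h
  · rw [show n + 1 + (m : ℤ) = n + m + 1 by ring, ← h]; ring
  · intro k hk hk'
    simp only [Finset.mem_Icc] at hk
    rw [hm k t ht u hu _ (by lia), mul_zero]
  · intro h; simp at h; lia
  · intro k hk hk'
    rw [hm.pderiv_pderiv hI.isOpen ht hu (by lia)]
    rcases lt_or_ge (n + m) k with h | h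
    · rw [hm n t ht u hu k h]; ring
    · rw [(dependsOn_rhs E k).pderiv_eq_zero (by simp; lia)]; ring
  · intro h; simp at h; lia

/-- The leading coefficient of a symmetry is a product of separants, up to a factor depending on `t`
only. The ratio of the two sides does not depend on `n`, hence is a function of disjoint sets of
variables. -/
lemma IsGeneralizedSymmetry.exists_leading_eq (hG : IsGeneralizedSymmetry E J I G) (hJ : IsOpen J)
    (hE : IsFractional E O a b c) (hI : IsRegularDomain E a b c I) (hm : OrderLE J I G m)
    (hm2 : 2 ≤ m) (hmN : m ≤ N) :
    ∃ γ : ℝ → ℝ, ∀ t ∈ J, ∀ u ∈ box I, ∀ n : ℤ,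
      pderiv (onSeq G n t) (n + m) u = γ t * sepProd E m n u := by
  choose w hw using hI.nonempty
  let q : ℝ → ℤ → (ℤ → ℝ) → ℝ := fun t n u => pderiv (onSeq G n t) (n + m) u / sepProd E m n u
  have hstep : ∀ t ∈ J, ∀ u ∈ box I, ∀ n, q t n u = q t (n + 1) u := by
    intro t ht u hu n
    have h1 := hG.leading_rel hJ hE hI.toIsLocalDomain hm hm2 hmN ht hu n
    have h2 := sepProd_succ E m n u
    rw [sepProd_succ'] at h2
    have h3 := hE.pderiv_rhs_ne_zero hI hu n
    have h4 := hE.pderiv_rhs_ne_zero hI hu (n + m)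
    have h5 := hE.sepProd_ne_zero hI hu m n
    have h6 := hE.sepProd_ne_zero hI hu m (n + 1)
    simp only [q]
    rw [div_eq_div_iff h5 h6]
    refine mul_left_cancel₀ h3 ?_
    linear_combination pderiv (onSeq G n t) (n + m) u * h2 + sepProd E m n u * h1
  have hconst : ∀ t ∈ J, ∀ u ∈ box I, ∀ n, q t n u = q t 0 u := by
    intro t ht u hu n
    induction n using Int.induction_on with
    | zero => rfl
    | succ n ih => rw [← hstep t ht u hu, ih]
    | pred n ih => rw [hstep t ht u hu, sub_add_cancel, ih]
  have hdep : ∀ t n, DependsOn (q t n) (Set.Icc (n - N) (n + N)) := by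
    intro t n u v h
    simp only [q]
    rw [(dependsOn_onSeq G n t).pderiv _ h, (dependsOn_sepProd E m n).superset
      (fun j hj => by simp only [Set.mem_Icc] at hj ⊢; lia) h]
  refine ⟨fun t => q t 0 w, fun t ht u hu n => ?_⟩
  have hq : q t 0 u = q t 0 w := by
    -- `v` agrees with `u` around the site `0` and with `w` around the site `2 * N + 1`
    let v : ℤ → ℝ := fun k => if k ≤ N then u k else w k
    have hv : v ∈ box I := fun k => by by_cases h : k ≤ N <;> simp [v, h, hu k, hw k]
    have e1 : q t 0 u = q t 0 v := hdep t 0 fun j hj => by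
      simp only [Set.mem_Icc] at hj
      simp only [v]
      rw [if_pos (by lia)]
    have e2 : q t (2 * N + 1) v = q t (2 * N + 1) w := hdep t _ fun j hj => by
      simp only [Set.mem_Icc] at hj
      simp only [v]
      rw [if_neg (by lia)]
    rw [e1, ← hconst t ht v hv (2 * N + 1), e2, hconst t ht w hw]
  change _ = q t 0 w * _
  rw [← hq, ← hconst t ht u hu n, div_mul_cancel₀ _ (hE.sepProd_ne_zero hI hu m n)]

/-- The sum of `∂f_{n+i}/∂u_{n+i}` for `i < m`. -/
noncomputable def centralSum (E : VolterraEq) (m : ℕ) (n : ℤ) (u : ℤ → ℝ) : ℝ :=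
  ∑ i ∈ Finset.range m, pderiv (E.rhs (n + i)) (n + i) u

/-- The relation between the coefficients `∂g_n/∂u_{n+m-1}`: up to a constant, the sum of `m`
consecutive functions `∂_t log (∂f_k/∂u_{k+1})` is a difference `S_{n+1} - S_n`. -/
lemma IsGeneralizedSymmetry.sum_flowDeriv_eq (hG : IsGeneralizedSymmetry E J I G) (hJ : IsOpen J)
    (hE : IsFractional E O a b c) (hI : IsRegularDomain E a b c I) (hm : OrderLE J I G (m + 1))
    (hm2 : 1 ≤ m) (hmN : m + 1 ≤ N) {γ : ℝ → ℝ}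
    (hγ : ∀ t ∈ J, ∀ u ∈ box I, ∀ n : ℤ,
      pderiv (onSeq G n t) (n + (m + 1 : ℕ)) u = γ t * sepProd E (m + 1) n u)
    (ht : t ∈ J) (hγt : γ t ≠ 0) (hu : u ∈ box I) (n : ℤ) :
    ∑ i ∈ Finset.range (m + 1), flowDeriv E 1 (logSeparant E (n + i)) (n + i) u =
      (pderiv (onSeq G (n + 1) t) (n + 1 + m) u / (γ t * sepProd E m (n + 1) u) -
        centralSum E (m + 1) (n + 1) u) -
      (pderiv (onSeq G n t) (n + m) u / (γ t * sepProd E m n u) - centralSum E (m + 1) n u) -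
      deriv γ t / γ t := by
  set M : ℕ := m + 1 with hM
  set A : ℤ → ℝ := fun k => flowDeriv E 1 (logSeparant E k) k u with hA
  have h := hG.linearized hJ hE hI.toIsLocalDomain ht hu (n := n) (p := n + M) (by lia)
  -- the coefficient depending on `t`
  have h1 : deriv (fun τ => pderiv (onSeq G n τ) (n + M) u) t = deriv γ t * sepProd E M n u := by
    rw [← deriv_mul_const_field]
    refine Filter.EventuallyEq.deriv_eq ?_
    filter_upwards [hJ.mem_nhds ht] with τ hτ using hγ τ hτ u hu n
  -- the derivative of the leading coefficient along the equation
  have h2 : ∑ k ∈ Finset.Icc (n - (N : ℤ)) (n + N),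
      pderiv (pderiv (onSeq G n t) (n + M)) k u * E.rhs k u =
      γ t * sepProd E M n u * ∑ i ∈ Finset.range M, A (n + i) := by
    have e1 : ∀ k, pderiv (pderiv (onSeq G n t) (n + M)) k u =
        γ t * (sepProd E M n u * ∑ i ∈ Finset.range M, pderiv (logSeparant E (n + i)) k u) := by
      intro k
      rw [pderiv_congr_box hI.isOpen (fun v hv => hγ t ht v hv n) hu, ← hE.pderiv_sepProd hI hu]
      simp only [pderiv, deriv_const_mul_field]
    have e2 : ∀ i ∈ Finset.range M, A (n + i) =
        ∑ k ∈ Finset.Icc (n - (N : ℤ)) (n + N), pderiv (logSeparant E (n + i)) k u * E.rhs k u := by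
      intro i hi
      rw [Finset.mem_range] at hi
      refine Finset.sum_subset (fun k hk => ?_) fun k _ hk => ?_
      · simp only [Finset.mem_Icc] at hk ⊢; lia
      · rw [(dependsOn_logSeparant E _).pderiv_eq_zero, zero_mul]
        simpa using hk
    rw [Finset.sum_congr rfl e2, Finset.sum_comm, Finset.mul_sum]
    refine Finset.sum_congr rfl fun k _ => ?_
    rw [e1, ← Finset.sum_mul]
    ring
  -- the remaining terms
  have h3 : ∑ k ∈ Finset.Icc (n - (N : ℤ)) (n + N),
      pderiv (onSeq G n t) k u * pderiv (E.rhs k) (n + M) u =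
      pderiv (onSeq G n t) (n + m) u * pderiv (E.rhs (n + m)) (n + m + 1) u +
      γ t * sepProd E M n u * pderiv (E.rhs (n + M)) (n + M) u := by
    have hs : ({n + (m : ℤ), n + (M : ℤ)} : Finset ℤ) ⊆ Finset.Icc (n - (N : ℤ)) (n + N) := by
      intro k hk
      simp only [Finset.mem_insert, Finset.mem_singleton, Finset.mem_Icc] at hk ⊢
      lia
    rw [← Finset.sum_subset hs, Finset.sum_pair (by lia), hγ t ht u hu n]
    · rw [hM]; push_cast; rw [← add_assoc]
    · intro k _ hk
      simp only [Finset.mem_insert, Finset.mem_singleton, not_or] at hk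
      rcases lt_or_ge (n + (M : ℤ)) k with h | h
      · rw [hm n t ht u hu k h, zero_mul]
      · rw [(dependsOn_rhs E k).pderiv_eq_zero (by simp; lia), mul_zero]
  have h4 : ∑ k ∈ Finset.Icc (n - 1) (n + 1), pderiv (E.rhs n) k u *
      pderiv (onSeq G k t) (n + M) u =
      pderiv (E.rhs n) n u * (γ t * sepProd E M n u) +
      pderiv (E.rhs n) (n + 1) u * pderiv (onSeq G (n + 1) t) (n + 1 + m) u := by
    have hs : ({n, n + 1} : Finset ℤ) ⊆ Finset.Icc (n - 1) (n + 1) := by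
      intro k hk
      simp only [Finset.mem_insert, Finset.mem_singleton, Finset.mem_Icc] at hk ⊢
      lia
    rw [← Finset.sum_subset hs, Finset.sum_pair (by lia), hγ t ht u hu n]
    · rw [show n + 1 + (m : ℤ) = n + M by rw [hM]; push_cast; ring]
    · intro k hk hk'
      simp only [Finset.mem_insert, Finset.mem_singleton, not_or, Finset.mem_Icc] at hk hk'
      rw [hm k t ht u hu _ (by lia), mul_zero]
  rw [Finset.sum_add_distrib, h1, h2, h3, h4] at h
  have hc : centralSum E M (n + 1) u - centralSum E M n u =
      pderiv (E.rhs (n + M)) (n + M) u - pderiv (E.rhs n) n u := by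
    have e : ∀ i : ℕ, pderiv (E.rhs (n + 1 + i)) (n + 1 + i) u =
        pderiv (E.rhs (n + (i + 1 : ℕ))) (n + (i + 1 : ℕ)) u := by
      intro i
      rw [show n + 1 + (i : ℤ) = n + (i + 1 : ℕ) by push_cast; ring]
    simp only [centralSum, e]
    rw [← Finset.sum_sub_distrib, Finset.sum_range_sub
      (fun i : ℕ => pderiv (E.rhs (n + i)) (n + i) u)]
    simp
  have p1 := sepProd_succ E m n u
  have p2 := sepProd_succ' E m n u
  have n1 := hE.sepProd_ne_zero hI hu M n
  have n2 := hE.sepProd_ne_zero hI hu m n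
  have n3 := hE.sepProd_ne_zero hI hu m (n + 1)
  have q1 : pderiv (onSeq G n t) (n + m) u / (γ t * sepProd E m n u) * (γ t * sepProd E M n u) =
      pderiv (onSeq G n t) (n + m) u * pderiv (E.rhs (n + m)) (n + m + 1) u := by
    rw [p1]; field_simp
  have q2 : pderiv (onSeq G (n + 1) t) (n + 1 + m) u / (γ t * sepProd E m (n + 1) u) *
      (γ t * sepProd E M n u) =
      pderiv (E.rhs n) (n + 1) u * pderiv (onSeq G (n + 1) t) (n + 1 + m) u := by
    rw [p2]; field_simp
  have q3 : deriv γ t / γ t * (γ t * sepProd E M n u) = deriv γ t * sepProd E M n u := by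
    field_simp
  refine mul_right_cancel₀ (mul_ne_zero hγt n1) ?_
  linear_combination h + q1 - q2 + q3 + γ t * sepProd E M n u * hc

lemma sum_range_eq_sum_Icc {F : ℤ → ℝ} {p q : ℤ} {L : ℕ} (hq : q ≤ p - 2) (hL : p + 2 < q + L)
    (hF : ∀ k, k ∉ Finset.Icc (p - 2) (p + 2) → F k = 0) :
    ∑ j ∈ Finset.range L, F (q + j) = ∑ k ∈ Finset.Icc (p - 2) (p + 2), F k := by
  rw [← Finset.sum_image (g := fun j : ℕ => q + (j : ℤ)) (f := F)
    (by intro i _ j _ h; simpa using h)]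
  refine (Finset.sum_subset (fun k hk => ?_) fun k _ hk => hF k hk).symm
  simp only [Finset.mem_Icc] at hk
  simp only [Finset.mem_image, Finset.mem_range]
  exact ⟨(k - q).toNat, by lia, by lia⟩

/-- A generalized symmetry of order `m + 1 ≥ 2` implies the first condition: the variational
derivative kills constants and telescoping sums. -/
theorem IsGeneralizedSymmetry.firstConditionOn (hG : IsGeneralizedSymmetry E J I G) (hJ : IsOpen J)
    (hE : IsFractional E O a b c) (hI : IsRegularDomain E a b c I) (hm : OrderLE J I G (m + 1))
    (hm2 : 1 ≤ m) {n₀ : ℤ} (ht : t ∈ J) {u₀ : ℤ → ℝ} (hu₀ : u₀ ∈ box I)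
    (h₀ : pderiv (onSeq G n₀ t) (n₀ + (m + 1 : ℕ)) u₀ ≠ 0) : FirstConditionOn E I := by
  have hmN : m + 1 ≤ N := by
    by_contra h
    exact h₀ ((dependsOn_onSeq G n₀ t).pderiv_eq_zero (by simp; lia) u₀)
  obtain ⟨γ, hγ⟩ := hG.exists_leading_eq hJ hE hI hm (by lia) hmN
  have hγt : γ t ≠ 0 := by
    intro h
    rw [hγ t ht u₀ hu₀, h, zero_mul] at h₀
    exact h₀ rfl
  intro u hu _ p
  set S : ℤ → (ℤ → ℝ) → ℝ := fun n v =>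
    pderiv (onSeq G n t) (n + m) v / (γ t * sepProd E m n v) - centralSum E (m + 1) n v with hS
  set A : ℤ → (ℤ → ℝ) → ℝ := fun k => flowDeriv E 1 (logSeparant E k) k with hA
  have hSdep : ∀ n, DependsOn (S n) (Set.Icc (n - N) (n + N)) := by
    intro n v w h
    simp only [hS, centralSum]
    rw [(dependsOn_onSeq G n t).pderiv _ h, (dependsOn_sepProd E m n).superset
      (fun j hj => by simp only [Set.mem_Icc] at hj ⊢; lia) h]
    congr 1
    refine Finset.sum_congr rfl fun i hi => ?_
    have := Finset.mem_range.1 hi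
    exact (dependsOn_rhs E _).pderiv _ fun j hj => h j (by simp only [Set.mem_Icc] at hj ⊢; lia)
  -- a sum over `2 * K` consecutive sites around `p`, with ends out of reach of `u_p`
  let K : ℕ := N + 3
  have hsum : ∀ v ∈ box I, ∑ j ∈ Finset.range (2 * K), ∑ i ∈ Finset.range (m + 1),
      A (p - K + i + j) v = S (p + K) v - S (p - K) v - (2 * K : ℕ) * (deriv γ t / γ t) := by
    intro v hv
    have e : ∀ j : ℕ, ∑ i ∈ Finset.range (m + 1), A (p - K + i + j) v =
        S (p - K + (j + 1 : ℕ)) v - S (p - K + j) v - deriv γ t / γ t := by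
      intro j
      have := hG.sum_flowDeriv_eq hJ hE hI hm hm2 hmN hγ ht hγt hv (p - K + j)
      simp only [hS, hA]
      rw [show p - (K : ℤ) + ((j + 1 : ℕ) : ℤ) = p - K + j + 1 by push_cast; ring, ← this]
      refine Finset.sum_congr rfl fun i _ => ?_
      rw [add_right_comm]
    rw [Finset.sum_congr rfl fun j _ => e j, Finset.sum_sub_distrib,
      Finset.sum_range_sub (fun j : ℕ => S (p - K + j) v)]
    simp only [Finset.sum_const, Finset.card_range, nsmul_eq_mul]
    congr 3
    · push_cast; ring
    · simp
  have hd : HasDerivAt (fun s => ∑ j ∈ Finset.range (2 * K), ∑ i ∈ Finset.range (m + 1),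
      A (p - K + i + j) (Function.update u p s))
      (∑ j ∈ Finset.range (2 * K), ∑ i ∈ Finset.range (m + 1), pderiv (A (p - K + i + j)) p u)
      (u p) :=
    HasDerivAt.fun_sum fun j _ => HasDerivAt.fun_sum fun i _ =>
      (hE.differentiableAt_flowDeriv hI hu _ p).hasDerivAt
  have hz : HasDerivAt (fun s => ∑ j ∈ Finset.range (2 * K), ∑ i ∈ Finset.range (m + 1),
      A (p - K + i + j) (Function.update u p s)) 0 (u p) := by
    refine (hasDerivAt_const (u p) (S (p + K) u - S (p - K) u -
      (2 * K : ℕ) * (deriv γ t / γ t))).congr_of_eventuallyEq ?_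
    filter_upwards [eventually_update_mem_box hI.isOpen hu p] with s hs
    rw [hsum _ hs, (hSdep _).update_eq (by simp only [Set.mem_Icc]; lia),
      (hSdep _).update_eq (by simp only [Set.mem_Icc]; lia)]
  have h0 := hd.unique hz
  have hi : ∀ i ∈ Finset.range (m + 1), ∑ j ∈ Finset.range (2 * K), pderiv (A (p - K + i + j)) p u =
      varDeriv 2 A p u := by
    intro i hi
    rw [Finset.mem_range] at hi
    refine sum_range_eq_sum_Icc (F := fun k => pderiv (A k) p u) (p := p) (q := p - K + i)
      (L := 2 * K) (by lia) (by lia) fun k hk => ?_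
    refine (dependsOn_flowDeriv E k).pderiv_eq_zero ?_ u
    simp only [Finset.mem_Icc, Set.mem_Icc] at hk ⊢
    lia
  rw [Finset.sum_comm, Finset.sum_congr rfl hi, Finset.sum_const, Finset.card_range, nsmul_eq_mul,
    mul_eq_zero] at h0
  exact h0.resolve_left (by positivity)

end

/-! ### Reflection of the lattice -/

/-- The reflection `n ↦ -n` of a sequence. -/
def reflect (u : ℤ → ℝ) : ℤ → ℝ := fun k => u (-k)

lemma reflect_update (u : ℤ → ℝ) (k : ℤ) (s : ℝ) :
    reflect (Function.update u k s) = Function.update (reflect u) (-k) s := by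
  funext i
  by_cases h : i = -k
  · subst h; simp [reflect]
  · have : -i ≠ k := fun h' => h (by lia)
    simp [reflect, h, this]

lemma pderiv_comp_reflect (f : (ℤ → ℝ) → ℝ) (k : ℤ) (u : ℤ → ℝ) :
    pderiv (fun v => f (reflect v)) k u = pderiv f (-k) (reflect u) := by
  simp [pderiv, reflect_update, reflect]

lemma reflect_mem_box {I : ℤ → Set ℝ} {u : ℤ → ℝ} (hu : u ∈ box fun k => I (-k)) :
    reflect u ∈ box I := fun k => by simpa [reflect] using hu (-k)

lemma sum_Icc_neg (F : ℤ → ℝ) (n l : ℤ) :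
    ∑ k ∈ Finset.Icc (n - l) (n + l), F (-k) = ∑ k ∈ Finset.Icc (-n - l) (-n + l), F k := by
  refine Finset.sum_equiv (Equiv.neg ℤ) (fun k => ?_) fun k _ => rfl
  simp only [Finset.mem_Icc, Equiv.neg_apply]
  lia

/-- The family `g_n(t, u)` transformed by `n ↦ -n`, `t ↦ -t`. -/
def reflectFamily {N : ℕ} (G : ℤ → ℝ × Window N → ℝ) (n : ℤ) (q : ℝ × Window N) : ℝ :=
  G (-n) (-q.1, fun i => q.2 ⟨-i, by have := Finset.mem_Icc.1 i.2; simp; lia⟩)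

lemma onSeq_reflectFamily {N : ℕ} (G : ℤ → ℝ × Window N → ℝ) (n : ℤ) (t : ℝ) (u : ℤ → ℝ) :
    onSeq (reflectFamily G) n t u = onSeq G (-n) (-t) (reflect u) := by
  simp only [onSeq, reflectFamily]
  congr 2
  funext i
  simp only [window, reflect]
  congr 1
  lia

section

variable {E : VolterraEq} {O : Set ℝ} {a b c : ℝ → ℝ} {J : Set ℝ} {I : ℤ → Set ℝ} {N : ℕ}
  {G : ℤ → ℝ × Window N → ℝ} {t : ℝ} {u : ℤ → ℝ}

lemma IsFractional.rhs_reflect (hE : IsFractional E O a b c) (n : ℤ) (u : ℤ → ℝ) :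
    E.rhs n u = -E.rhs (-n) (reflect u) := by
  simp only [hE.rhs_eq, reflect, neg_neg]
  rw [show -(-n + 1) = n - 1 by ring, show -(-n - 1) = n + 1 by ring, ← div_neg, neg_sub]
  ring

lemma IsLocalDomain.reflect (hI : IsLocalDomain E I) (hE : IsFractional E O a b c) :
    IsLocalDomain E fun k => I (-k) where
  isOpen k := hI.isOpen _
  ordConnected k := hI.ordConnected _
  nonempty k := hI.nonempty _
  admissible u hu n := by
    have := hI.admissible _ (reflect_mem_box hu) (-n)
    refine hE.dom_symm _ _ _ ?_
    simpa only [Lattice.reflect, neg_neg, show -(-n + 1) = n - 1 by ring,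
      show -(-n - 1) = n + 1 by ring] using this

/-- The equation is invariant under `n ↦ -n`, `t ↦ -t`; hence so is the set of its symmetries. -/
lemma IsGeneralizedSymmetry.reflect (hG : IsGeneralizedSymmetry E J I G)
    (hE : IsFractional E O a b c) :
    IsGeneralizedSymmetry E (Neg.neg ⁻¹' J) (fun k => I (-k)) (reflectFamily G) where
  smooth n := by
    refine (hG.smooth (-n)).comp ?_ ?_
    · have hc : ∀ i, ContDiff ℝ ∞ fun q : ℝ × Window N => q.2 i := fun i =>
        contDiff_pi.1 contDiff_snd i
      refine ContDiff.contDiffOn (contDiff_fst.neg.prodMk ?_)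
      exact contDiff_pi.2 fun i =>
        hc ⟨-i, by have := Finset.mem_Icc.1 i.2; simp; lia⟩
    · rintro ⟨t, w⟩ ⟨ht, hw⟩
      refine ⟨ht, fun i => ?_⟩
      have := hw ⟨-i, by have := Finset.mem_Icc.1 i.2; simp; lia⟩
      simpa only [neg_add, neg_neg] using this
  determining n t ht u hu := by
    have h := hG.determining (-n) (-t) ht _ (reflect_mem_box hu)
    have e1 : deriv (fun s => onSeq (reflectFamily G) n s u) t =
        -deriv (fun s => onSeq G (-n) s (Lattice.reflect u)) (-t) := by
      simp only [onSeq_reflectFamily]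
      exact deriv_comp_neg (fun s => onSeq G (-n) s (Lattice.reflect u)) t
    have e2 : ∀ k, pderiv (onSeq (reflectFamily G) n t) k u =
        pderiv (onSeq G (-n) (-t)) (-k) (Lattice.reflect u) := by
      intro k
      rw [← pderiv_comp_reflect]
      congr 1
      funext v
      exact onSeq_reflectFamily G n t v
    have e3 : ∀ k, pderiv (E.rhs n) k u = -pderiv (E.rhs (-n)) (-k) (Lattice.reflect u) := by
      intro k
      rw [← pderiv_comp_reflect, show E.rhs n = fun v => -E.rhs (-n) (Lattice.reflect v) from
        funext fun v => hE.rhs_reflect n v]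
      simp only [pderiv, deriv.fun_neg]
    rw [e1]
    simp only [flowDeriv, e2, e3, onSeq_reflectFamily, hE.rhs_reflect _ u] at h ⊢
    rw [← sum_Icc_neg _ n N, ← sum_Icc_neg _ n 1] at h
    simp only [mul_neg, neg_mul, Finset.sum_neg_distrib]
    linarith

/-! ### Equations without higher symmetries -/

/-- If the first condition fails on all regular local domains, no symmetry depends on `u_{n+j}` with
`j ≥ 2`. -/
lemma IsGeneralizedSymmetry.pderiv_eq_zero_of_two_le (hG : IsGeneralizedSymmetry E J I G)
    (hJ : IsOpen J) (hE : IsFractional E O a b c) (hI : IsLocalDomain E I)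
    (hF : ∀ I' : ℤ → Set ℝ, IsRegularDomain E a b c I' → ¬ FirstConditionOn E I')
    (ht : t ∈ J) (hu : u ∈ box I) (n j : ℤ) (hj : 2 ≤ j) :
    pderiv (onSeq G n t) (n + j) u = 0 := by
  classical
  by_contra hne
  let P : ℕ → Prop := fun m => ∃ n, ∃ t ∈ J, ∃ u ∈ box I, pderiv (onSeq G n t) (n + m) u ≠ 0
  have hPN : ∀ m, P m → m ≤ N := by
    rintro m ⟨n, t, -, u, -, h⟩
    by_contra hm
    exact h ((dependsOn_onSeq G n t).pderiv_eq_zero (by simp; lia) u)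
  have hPj : P j.toNat := ⟨n, t, ht, u, hu, by rwa [Int.toNat_of_nonneg (by lia)]⟩
  obtain ⟨m, hm2, ⟨n, t, ht, u, hu, hmne⟩, hmax⟩ : ∃ m, 2 ≤ m ∧ P m ∧ ∀ k, m < k → ¬ P k :=
    ⟨Nat.findGreatest P N, le_trans (by lia) (Nat.le_findGreatest (hPN _ hPj) hPj),
      Nat.findGreatest_spec (hPN _ hPj) hPj, fun k hk hPk =>
        Nat.findGreatest_is_greatest hk (hPN _ hPk) hPk⟩
  -- near `u` the leading coefficient does not vanish
  have hcont : ContinuousAt (fun w => fderiv ℝ (G n) (t, w) (windowDir N n (n + m)))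
      (window N n u) := by
    have h1 := (hG.fderiv_differentiableAt hJ hI.isOpen ht hu n).continuousAt
    have h2 : ContinuousAt (fun w : Window N => fderiv ℝ (G n) (t, w)) (window N n u) :=
      ContinuousAt.comp' (f := fun w : Window N => (t, w)) h1 (by fun_prop)
    exact h2.clm_apply continuousAt_const
  rw [hG.pderiv_eq hJ hI.isOpen ht hu] at hmne
  obtain ⟨ε, hε, hball⟩ := Metric.eventually_nhds_iff.1 (hcont.eventually_ne hmne)
  have hI₁ : IsLocalDomain E fun k => I k ∩ Metric.ball (u k) ε :=
    hI.mono (fun k => (hI.isOpen k).inter Metric.isOpen_ball)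
      (fun k => by
        rw [Real.ball_eq_Ioo]
        exact (hI.ordConnected k).inter Set.ordConnected_Ioo)
      (fun k => ⟨u k, hu k, Metric.mem_ball_self hε⟩) fun k => Set.inter_subset_left
  obtain ⟨I', hI'sub, hI'⟩ := hE.exists_isRegularDomain hI₁
  have hsub : ∀ k, I' k ⊆ I k := fun k x hx => (hI'sub k hx).1
  choose v hv using hI'.nonempty
  have hvI : v ∈ box I := fun k => hsub k (hv k)
  have hvne : pderiv (onSeq G n t) (n + m) v ≠ 0 := by
    rw [hG.pderiv_eq hJ hI.isOpen ht hvI]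
    exact hball ((dist_pi_lt_iff hε).2 fun i => (hI'sub _ (hv _)).2)
  obtain ⟨l, rfl⟩ : ∃ l, m = l + 1 := ⟨m - 1, by lia⟩
  refine hF I' hI' ((hG.mono hsub).firstConditionOn hJ hE hI' (m := l) ?_ (by lia) ht hv hvne)
  intro n t ht u hu p hp
  by_contra h
  exact hmax (p - n).toNat (by lia) ⟨n, t, ht, u, fun k => hsub k (hu k), by
    rwa [Int.toNat_of_nonneg (by lia), add_sub_cancel]⟩

/-- If the numerator is not symmetric on any product of two intervals of admissible values, then the
equation has no higher symmetry, and it violates the first condition on every local domain. -/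
theorem IsFractional.not_hasHigherSymmetry_and_not_firstConditionOn (hE : IsFractional E O a b c)
    (hns : ∀ U W : Set ℝ, IsOpen U → IsOpen W → U.Nonempty → W.Nonempty → U ⊆ O → W ⊆ O →
      ¬ ∀ u ∈ U, ∀ x ∈ W, diag a b c x u = diag a b c u x) :
    ¬ HasHigherSymmetry E ∧ ∀ I : ℤ → Set ℝ, IsLocalDomain E I → ¬ FirstConditionOn E I := by
  have hreg : ∀ I : ℤ → Set ℝ, IsRegularDomain E a b c I → ¬ FirstConditionOn E I := by
    intro I hI hF
    choose w hw using hI.nonempty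
    have hO : ∀ k, I k ⊆ O := fun k x hx => by
      simpa using hI.mem hE (update_mem_box hw hx) k
    exact hns (I 1) (I 2) (hI.isOpen _) (hI.isOpen _) (hI.nonempty _) (hI.nonempty _) (hO _) (hO _)
      fun u hu x hx => hF.diag_symm hE hI hu hx
  refine ⟨?_, fun I hI hF => ?_⟩
  · rintro ⟨J, I, N, G, hJ, hI, hG, n, t, ht, u, hu, j, hj, hne⟩
    rcases le_abs.1 hj with hj | hj
    · exact hne (hG.pderiv_eq_zero_of_two_le hJ hE hI hreg ht hu n j hj)
    · have h := (hG.reflect hE).pderiv_eq_zero_of_two_le (hJ.preimage continuous_neg) hE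
        (hI.reflect hE) hreg (t := -t) (u := reflect u) (by simpa using ht)
        (fun k => hu (-k)) (-n) (-j) hj
      have e : onSeq (reflectFamily G) (-n) (-t) = fun v => onSeq G n t (reflect v) := by
        funext v
        simp [onSeq_reflectFamily]
      have er : reflect (reflect u) = u := by funext k; simp [reflect]
      rw [e, pderiv_comp_reflect, er] at h
      exact hne (by simpa [add_comm] using h)
  · obtain ⟨I', hsub, hI'⟩ := hE.exists_isRegularDomain hI
    exact hreg I' hI' fun u hu => hF u fun k => hsub k (hu k)

end

end Lattice

theorem mainTheorem3 :
    (∀ ρ : ℝ, ρ ≠ 0 →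
      ¬ Lattice.HasHigherSymmetry (Lattice.eqArctan ρ) ∧
      ∀ I : ℤ → Set ℝ, Lattice.IsLocalDomain (Lattice.eqArctan ρ) I →
        ¬ Lattice.FirstConditionOn (Lattice.eqArctan ρ) I) ∧
    (∀ ρ A B : ℝ, ρ ≠ 0 →
      ¬ (ρ = 1 ∧ A = 1 / 2 ∧ B = 0) → ¬ (ρ = 2 ∧ A = 0 ∧ B = 0) →
      ¬ Lattice.HasHigherSymmetry (Lattice.eqPower ρ A B) ∧
      ∀ I : ℤ → Set ℝ, Lattice.IsLocalDomain (Lattice.eqPower ρ A B) I →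
        ¬ Lattice.FirstConditionOn (Lattice.eqPower ρ A B) I) ∧
    (∀ A : ℝ,
      ¬ Lattice.HasHigherSymmetry (Lattice.eqExp A) ∧
      ∀ I : ℤ → Set ℝ, Lattice.IsLocalDomain (Lattice.eqExp A) I →
        ¬ Lattice.FirstConditionOn (Lattice.eqExp A) I) := by
  refine ⟨fun ρ hρ => ?_, fun ρ A B hρ h1 h2 => ?_, fun A => ?_⟩
  · exact (Lattice.isFractional_eqArctan ρ).not_hasHigherSymmetry_and_not_firstConditionOn
      fun U W _ hW hUne hWne _ _ => Lattice.not_diag_symm_eqArctan hρ hW hUne hWne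
  · exact (Lattice.isFractional_eqPower ρ A B).not_hasHigherSymmetry_and_not_firstConditionOn
      fun U W hU hW hUne hWne hU0 hW0 =>
        Lattice.not_diag_symm_eqPower hρ h1 h2 hU hW hUne hWne hU0 hW0
  · exact (Lattice.isFractional_eqExp A).not_hasHigherSymmetry_and_not_firstConditionOn
      fun U W hU hW hUne hWne _ _ => Lattice.not_diag_symm_eqExp hU hW hUne hWne
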